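/- **Setting.** Let $d\ge 1$, let $\Theta\subset\mathbb R^d$ be bounded, open and convex (for example $\{\|\theta\|<B\}$), and let $\ell(\theta;x,y)$ be a loss with $\theta\in\Theta$, $x\in\mathbb R^p$, $y\in\{0,1\}$, measurable in $x$ and twice differentiable in $\theta$, such that $\ell,\nabla_\theta\ell,\nabla^2_\theta\ell$ are bounded on $\Theta\times\{\|x\|\le r\}$ for every $r$. Let $\mathcal P_0,\mathcal P_1$ be fixed probability distributions on $\mathbb R^p$ (majority and minority class), and let $n_0>n_1$ be sample sizes with $n_0\to\infty$ along a sequence. Let $\mathcal P_{\rm syn}$ be a probability distribution on $\mathbb R^p$ (the synthetic generator), which may vary along the sequence, and let $\tilde n$ be the synthetic size. Put $N=n_0+n_1+\tilde n$, $\pi_0=n_0/N$, $\pi_1=n_1/N$, $\tilde\pi=\tilde n/N$, and $$\mathcal R(\theta)=\tfrac12\mathbb E_{\mathcal P_0}\ell(\theta;x,0)+\tfrac12\mathbb E_{\mathcal P_1}\ell(\theta;x,1),\qquad \tilde{\mathcal R}(\theta)=\pi_0\mathbb E_{\mathcal P_0}\ell(\theta;x,0)+\pi_1\mathbb E_{\mathcal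 P_1}\ell(\theta;x,1)+\tilde\pi\,\mathbb E_{\mathcal P_{\rm syn}}\ell(\theta;x,1),$$ $$\phi(\theta)=\mathbb E_{\mathcal P_0}\ell(\theta;x,0)-\mathbb E_{\mathcal P_1}\ell(\theta;x,1),\qquad \psi(\theta)=\mathbb E_{\mathcal P_{\rm syn}}\ell(\theta;x,1)-\mathbb E_{\mathcal P_1}\ell(\theta;x,1),$$ with minimizers $\theta^*$ of $\mathcal R$ and $\tilde\theta$ of $\tilde{\mathcal R}$ over $\Theta$. Let $\Sigma_0(\theta),\Sigma_1(\theta),\tilde\Sigma(\theta)$ be the covariance matrices of $\nabla_\theta\ell(\theta;x,0)$ under $\mathcal P_0$ and of $\nabla_\theta\ell(\theta;x,1)$ under $\mathcal P_1$ and $\mathcal P_{\rm syn}$, and $\Sigma=\pi_0\Sigma_0+\pi_1\Sigma_1+\tilde\pi\tilde\Sigma$. Let $\hat\theta$ be any minimizer over $\Theta$ (whenever one exists) of the empirical risk $$\hat{\mathcal R}(\theta)=\frac1N\Big(\sum_{i=1}^{n_0}\ell(\theta;x^{(0)}_i,0)+\sum_{i=1}^{n_1}\ell(\theta;x^{(1)}_i,1)+\sum_{i=1}^{\tilde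 n}\ell(\theta;\tilde x_i,1)\Big),$$ where all $x^{(0)}_i\sim\mathcal P_0$, $x^{(1)}_i\sim\mathcal P_1$, $\tilde x_i\sim\mathcal P_{\rm syn}$ are independent. **Regularity conditions** (for the sizes $n_0,n_1,\tilde n$; all constants are positive and do not depend on the sizes): 1. $\mathcal R$ is differentiable, and for all $\theta\in\Theta$, $\mathcal R(\theta^*)\ge\mathcal R(\theta)+\nabla\mathcal R(\theta)^\top(\theta^*-\theta)+\frac{\mu}{2}\|\theta^*-\theta\|^2$ and $\mathcal R(\theta)-\mathcal R(\theta^*)\ge L\|\theta-\theta^*\|^2$. 2. $\mathcal P_0,\mathcal P_1,\mathcal P_{\rm syn}$ are supported in a common bounded set. 3. $\nabla^2\tilde{\mathcal R}(\theta)\succeq\lambda I$ and $\|\nabla^2\tilde{\mathcal R}(\theta)-\nabla^2\tilde{\mathcal R}(\tilde\theta)\|\le L\|\theta-\tilde\theta\|$ for all $\theta\in\Theta$. 4. $\Sigma_0(\tilde\theta),\Sigma_1(\tilde\theta),\tilde\Sigma(\tilde\theta)\succ\lambda I$ have bounded largest eigenvalues, and $\|\Sigma(\tilde\theta)-\Sigma(\theta^*)\|\le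 L\|\tilde\theta-\theta^*\|$. 5. $\|(\pi_0-\frac12)\nabla^2\phi(\theta)+\tilde\pi\nabla^2\psi(\theta)\|\le C$ for all $\theta\in\Theta$. **Theorem 3 (Excess risk under an ideal synthetic generator).** Suppose that $\|\nabla^2\psi(\theta^*)\|\le\lambda_{\min}(\nabla^2\mathcal R(\theta^*))$ and that the generator is ideal, $\|\nabla\psi(\theta^*)\|\ll n_0^{-1/2}$ (that is, $\sqrt{n_0}\,\|\nabla\psi(\theta^*)\|\to0$). Let $\mathscr C$ be the class of synthetic sizes $\tilde n=n_0-n_1+o(\sqrt{n_0})$. Then for every $\tilde n\in\mathscr C$ for which the regularity conditions hold, $$\mathcal R(\hat\theta)-\mathcal R(\theta^*)=\Theta_P(n_0^{-1}),$$ that is, $n_0\,(\mathcal R(\hat\theta)-\mathcal R(\theta^*))$ is stochastically bounded and stochastically bounded away from zero. The naive balancing size $\tilde n=n_0-n_1$ belongs to $\mathscr C$, so it already attains this rate, and the other sizes in $\mathscr C$ can improve only the constants. -/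

import Mathlib

open MeasureTheory ProbabilityTheory Filter Topology Asymptotics
open scoped RealInnerProductSpace Gradient

noncomputable section

/-! ### Stochastic order notation

The `k`-th random variable lives on its own probability space `(Ω k, μ k)`. Sets are measured by
the (outer) measure `μ k`, so no measurability of `X k` is presupposed. -/

/-- `X = O_P(a)`: the ratio `X / a` is stochastically bounded. -/
def IsBigOP {Ω : ℕ → Type*} [∀ k, MeasurableSpace (Ω k)] (μ : ∀ k, Measure (Ω k))
    (X : ∀ k, Ω k → ℝ) (a : ℕ → ℝ) : Prop :=
  ∀ ε : ℝ, 0 < ε → ∃ C : ℝ, 0 < C ∧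
    ∀ᶠ k in atTop, μ k {ω | C * |a k| < |X k ω|} ≤ ENNReal.ofReal ε

/-- `X = Ω_P(a)`: the ratio `X / a` is stochastically bounded away from zero. -/
def IsOmegaP {Ω : ℕ → Type*} [∀ k, MeasurableSpace (Ω k)] (μ : ∀ k, Measure (Ω k))
    (X : ∀ k, Ω k → ℝ) (a : ℕ → ℝ) : Prop :=
  ∀ ε : ℝ, 0 < ε → ∃ c : ℝ, 0 < c ∧
    ∀ᶠ k in atTop, μ k {ω | |X k ω| < c * |a k|} ≤ ENNReal.ofReal ε

/-- `X = Θ_P(a)`: both `X = O_P(a)` and `X = Ω_P(a)`. -/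
def IsThetaP {Ω : ℕ → Type*} [∀ k, MeasurableSpace (Ω k)] (μ : ∀ k, Measure (Ω k))
    (X : ∀ k, Ω k → ℝ) (a : ℕ → ℝ) : Prop :=
  IsBigOP μ X a ∧ IsOmegaP μ X a

/-! ### Minimizers, Hessians, eigenvalues -/

/-- `θ` minimizes `f` over `Θ`. -/
def IsArgmin {E : Type*} (f : E → ℝ) (Θ : Set E) (θ : E) : Prop :=
  θ ∈ Θ ∧ ∀ θ' ∈ Θ, f θ ≤ f θ'

/-- The parameter space `ℝ^d` and the covariate space `ℝ^p`, with the Euclidean norm. -/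
abbrev Vec (n : ℕ) : Type := EuclideanSpace ℝ (Fin n)

/-- The Hessian `∇²f(θ)`, the derivative of the gradient; its norm is the operator norm. -/
def hessian {d : ℕ} (f : Vec d → ℝ) (θ : Vec d) : Vec d →L[ℝ] Vec d :=
  fderiv ℝ (∇ f) θ

/-- The smallest (real) eigenvalue of an operator on `ℝ^d`. -/
def lambdaMin {d : ℕ} (A : Vec d →L[ℝ] Vec d) : ℝ :=
  sInf {μ : ℝ | Module.End.HasEigenvalue (A : Vec d →ₗ[ℝ] Vec d) μ}

/-! ### Population risks

A loss is a function `ℓ θ x y` of the parameter, the covariate and the label `y ∈ {0, 1}`. -/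

variable {d p : ℕ}

/-- The class risk `E_P ℓ(θ; x, y)`. -/
def classRisk (ℓ : Vec d → Vec p → Fin 2 → ℝ) (P : Measure (Vec p)) (y : Fin 2)
    (θ : Vec d) : ℝ :=
  ∫ x, ℓ θ x y ∂P

/-- The balanced population risk `R`. -/
def balancedRisk (ℓ : Vec d → Vec p → Fin 2 → ℝ) (P₀ P₁ : Measure (Vec p)) (θ : Vec d) : ℝ :=
  1 / 2 * classRisk ℓ P₀ 0 θ + 1 / 2 * classRisk ℓ P₁ 1 θ

/-- The majority-minority asymmetry `φ`. -/
def phi (ℓ : Vec d → Vec p → Fin 2 → ℝ) (P₀ P₁ : Measure (Vec p)) (θ : Vec d) : ℝ :=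
  classRisk ℓ P₀ 0 θ - classRisk ℓ P₁ 1 θ

/-- The synthetic-minority discrepancy `ψ`. -/
def psi (ℓ : Vec d → Vec p → Fin 2 → ℝ) (P₁ Psyn : Measure (Vec p)) (θ : Vec d) : ℝ :=
  classRisk ℓ Psyn 1 θ - classRisk ℓ P₁ 1 θ

/-- The share `a / (n₀ + n₁ + m)` of a group of `a` observations in the augmented sample of
`n₀` majority, `n₁` minority and `m` synthetic observations: `π₀`, `π₁`, `π̃` for
`a = n₀, n₁, m`. -/
def share (a n₀ n₁ m : ℕ) : ℝ := (a : ℝ) / ((n₀ : ℝ) + n₁ + m)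

/-- The synthetic population risk `R̃`. -/
def syntheticRisk (ℓ : Vec d → Vec p → Fin 2 → ℝ) (P₀ P₁ Psyn : Measure (Vec p))
    (n₀ n₁ m : ℕ) (θ : Vec d) : ℝ :=
  share n₀ n₀ n₁ m * classRisk ℓ P₀ 0 θ + share n₁ n₀ n₁ m * classRisk ℓ P₁ 1 θ
    + share m n₀ n₁ m * classRisk ℓ Psyn 1 θ

/-- `∇b(θ) = (π₀ - 1/2) ∇²φ(θ) + π̃ ∇²ψ(θ)`, the Jacobian of the first-order bias vector. -/
def biasJacobian (ℓ : Vec d → Vec p → Fin 2 → ℝ) (P₀ P₁ Psyn : Measure (Vec p))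
    (n₀ n₁ m : ℕ) (θ : Vec d) : Vec d →L[ℝ] Vec d :=
  (share n₀ n₀ n₁ m - 1 / 2) • hessian (phi ℓ P₀ P₁) θ
    + share m n₀ n₁ m • hessian (psi ℓ P₁ Psyn) θ

/-- The covariance `Cov_P(∇_θ ℓ(θ; x, y))` of the loss gradient, as a bilinear form on `ℝ^d`
(its norm is the spectral norm of the covariance matrix). -/
def gradCov (ℓ : Vec d → Vec p → Fin 2 → ℝ) (P : Measure (Vec p)) (y : Fin 2) (θ : Vec d) :
    Vec d →L[ℝ] Vec d →L[ℝ] ℝ :=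
  covarianceBilin (P.map fun x => ∇ (fun θ' => ℓ θ' x y) θ)

/-- The pooled covariance `Σ(θ)`. -/
def pooledCov (ℓ : Vec d → Vec p → Fin 2 → ℝ) (P₀ P₁ Psyn : Measure (Vec p))
    (n₀ n₁ m : ℕ) (θ : Vec d) : Vec d →L[ℝ] Vec d →L[ℝ] ℝ :=
  share n₀ n₀ n₁ m • gradCov ℓ P₀ 0 θ + share n₁ n₀ n₁ m • gradCov ℓ P₁ 1 θ
    + share m n₀ n₁ m • gradCov ℓ Psyn 1 θ

/-! ### Regularity conditions -/

/-- Standing regularity of the parameter set and the loss: `Θ` is bounded, open and convex (for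
instance `{θ : ‖θ‖ < B}`), the loss is twice differentiable in `θ ∈ Θ`, measurable in `x`, and the
loss and its first two derivatives in `θ` are bounded on bounded sets of `(θ, x)`. -/
structure LossRegular (Θ : Set (Vec d)) (ℓ : Vec d → Vec p → Fin 2 → ℝ) : Prop where
  isOpen : IsOpen Θ
  convex : Convex ℝ Θ
  bounded : Bornology.IsBounded Θ
  measurable : ∀ θ ∈ Θ, ∀ y, Measurable fun x => ℓ θ x y
  differentiable : ∀ θ ∈ Θ, ∀ x y, DifferentiableAt ℝ (fun θ' => ℓ θ' x y) θ
  twice_differentiable : ∀ θ ∈ Θ, ∀ x y, DifferentiableAt ℝ (∇ (fun θ' => ℓ θ' x y)) θ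
  bounded_on_bounded : ∀ r : ℝ, ∃ K : ℝ, ∀ θ ∈ Θ, ∀ x, ‖x‖ ≤ r → ∀ y,
    |ℓ θ x y| ≤ K ∧ ‖∇ (fun θ' => ℓ θ' x y) θ‖ ≤ K ∧ ‖hessian (fun θ' => ℓ θ' x y) θ‖ ≤ K

/-- The regularity conditions on the risks, along a sequence of sizes `(n₀ k, n₁ k, m k)` with
generator distributions `Psyn k`, balanced minimizer `θstar` and synthetic minimizers `θtilde k`.
All constants are independent of `k`. -/
structure RiskConditions (Θ : Set (Vec d)) (ℓ : Vec d → Vec p → Fin 2 → ℝ)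
    (P₀ P₁ : Measure (Vec p)) (Psyn : ℕ → Measure (Vec p)) (n₀ n₁ m : ℕ → ℕ)
    (θstar : Vec d) (θtilde : ℕ → Vec d) : Prop where
  /-- The balanced risk is differentiable, -/
  risk_differentiable : ∀ θ ∈ Θ, DifferentiableAt ℝ (balancedRisk ℓ P₀ P₁) θ
  /-- satisfies a strong convexity inequality at its minimizer, -/
  risk_strong_convexity : ∃ μ : ℝ, 0 < μ ∧ ∀ θ ∈ Θ,
    balancedRisk ℓ P₀ P₁ θ + ⟪∇ (balancedRisk ℓ P₀ P₁) θ, θstar - θ⟫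
      + μ / 2 * ‖θstar - θ‖ ^ 2 ≤ balancedRisk ℓ P₀ P₁ θstar
  /-- and grows quadratically around it. -/
  risk_quadratic_growth : ∃ L : ℝ, 0 < L ∧ ∀ θ ∈ Θ,
    L * ‖θ - θstar‖ ^ 2 ≤ balancedRisk ℓ P₀ P₁ θ - balancedRisk ℓ P₀ P₁ θstar
  /-- The covariates have bounded support (hence finite moments of every order). -/
  bounded_support : ∃ r : ℝ, (∀ᵐ x ∂P₀, ‖x‖ ≤ r) ∧ (∀ᵐ x ∂P₁, ‖x‖ ≤ r) ∧
    ∀ k, ∀ᵐ x ∂(Psyn k), ‖x‖ ≤ r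
  /-- `∇²R̃(θ) ⪰ λ I`, -/
  syn_hessian_lower : ∃ lam : ℝ, 0 < lam ∧ ∀ k, ∀ θ ∈ Θ, ∀ v : Vec d,
    lam * ‖v‖ ^ 2
      ≤ ⟪v, hessian (syntheticRisk ℓ P₀ P₁ (Psyn k) (n₀ k) (n₁ k) (m k)) θ v⟫
  /-- and `∇²R̃` is Lipschitz at `θ̃`. -/
  syn_hessian_lipschitz : ∃ L : ℝ, 0 < L ∧ ∀ k, ∀ θ ∈ Θ,
    ‖hessian (syntheticRisk ℓ P₀ P₁ (Psyn k) (n₀ k) (n₁ k) (m k)) θ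
      - hessian (syntheticRisk ℓ P₀ P₁ (Psyn k) (n₀ k) (n₁ k) (m k)) (θtilde k)‖
      ≤ L * ‖θ - θtilde k‖
  /-- `Σ₀(θ̃), Σ₁(θ̃), Σ̃(θ̃) ≻ λ I`, -/
  cov_lower : ∃ lam : ℝ, 0 < lam ∧ ∀ k, ∀ v : Vec d, v ≠ 0 →
    lam * ‖v‖ ^ 2 < gradCov ℓ P₀ 0 (θtilde k) v v ∧
    lam * ‖v‖ ^ 2 < gradCov ℓ P₁ 1 (θtilde k) v v ∧
    lam * ‖v‖ ^ 2 < gradCov ℓ (Psyn k) 1 (θtilde k) v v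
  /-- with largest eigenvalues bounded above, -/
  cov_upper : ∃ Lam : ℝ, ∀ k, ∀ v : Vec d,
    gradCov ℓ P₀ 0 (θtilde k) v v ≤ Lam * ‖v‖ ^ 2 ∧
    gradCov ℓ P₁ 1 (θtilde k) v v ≤ Lam * ‖v‖ ^ 2 ∧
    gradCov ℓ (Psyn k) 1 (θtilde k) v v ≤ Lam * ‖v‖ ^ 2
  /-- and `‖Σ(θ̃) - Σ(θ*)‖ ≤ L ‖θ̃ - θ*‖`. -/
  cov_lipschitz : ∃ L : ℝ, 0 < L ∧ ∀ k,
    ‖pooledCov ℓ P₀ P₁ (Psyn k) (n₀ k) (n₁ k) (m k) (θtilde k)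
      - pooledCov ℓ P₀ P₁ (Psyn k) (n₀ k) (n₁ k) (m k) θstar‖ ≤ L * ‖θtilde k - θstar‖
  /-- The gradient of the total bias is bounded. -/
  bias_bounded : ∃ C : ℝ, ∀ k, ∀ θ ∈ Θ,
    ‖biasJacobian ℓ P₀ P₁ (Psyn k) (n₀ k) (n₁ k) (m k) θ‖ ≤ C

/-! ### The augmented sample and the estimator -/

/-- Indices of the augmented sample: majority, minority, synthetic. -/
abbrev SampleIdx (n₀ n₁ m : ℕ) : Type := Fin n₀ ⊕ Fin n₁ ⊕ Fin m

/-- The label of an observation: `0` for majority, `1` for minority and synthetic. -/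
def sampleLabel {n₀ n₁ m : ℕ} : SampleIdx n₀ n₁ m → Fin 2 :=
  Sum.elim (fun _ => 0) (fun _ => 1)

/-- The distribution of an observation: `P₀`, `P₁` or `Psyn`. -/
def sampleLaw {n₀ n₁ m : ℕ} (P₀ P₁ Psyn : Measure (Vec p)) :
    SampleIdx n₀ n₁ m → Measure (Vec p) :=
  Sum.elim (fun _ => P₀) (Sum.elim (fun _ => P₁) (fun _ => Psyn))

/-- The covariates `X i` are independent random vectors with the distributions `sampleLaw`. -/
structure IsAugmentedSample {Ω : Type*} [MeasurableSpace Ω] (μ : Measure Ω)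
    (P₀ P₁ Psyn : Measure (Vec p)) {n₀ n₁ m : ℕ} (X : SampleIdx n₀ n₁ m → Ω → Vec p) :
    Prop where
  measurable : ∀ i, Measurable (X i)
  law : ∀ i, μ.map (X i) = sampleLaw P₀ P₁ Psyn i
  indep : iIndepFun X μ

/-- The empirical augmented risk `R̂` at the covariates `x`. -/
def empiricalRisk (ℓ : Vec d → Vec p → Fin 2 → ℝ) {n₀ n₁ m : ℕ}
    (x : SampleIdx n₀ n₁ m → Vec p) (θ : Vec d) : ℝ :=
  1 / ((n₀ : ℝ) + n₁ + m) * ∑ i, ℓ θ (x i) (sampleLabel i)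

/-- `θhat` is (almost surely) a minimizer of the empirical augmented risk over `Θ`, whenever one
exists. -/
def IsEmpiricalMinimizer {Ω : Type*} [MeasurableSpace Ω] (μ : Measure Ω) (Θ : Set (Vec d))
    (ℓ : Vec d → Vec p → Fin 2 → ℝ) {n₀ n₁ m : ℕ} (X : SampleIdx n₀ n₁ m → Ω → Vec p)
    (θhat : Ω → Vec d) : Prop :=
  ∀ᵐ ω ∂μ, (∃ θ, IsArgmin (empiricalRisk ℓ fun i => X i ω) Θ θ) →
    IsArgmin (empiricalRisk ℓ fun i => X i ω) Θ (θhat ω)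

/-- The class `𝒞` of synthetic sizes `m = n₀ - n₁ + o(√n₀)`. -/
def balancingSizes (n₀ n₁ : ℕ → ℕ) : Set (ℕ → ℕ) :=
  {m | (fun k => (m k : ℝ) - ((n₀ k : ℝ) - n₁ k)) =o[atTop] fun k => √(n₀ k : ℝ)}

end

/-! The estimator lies at distance of exact order `n₀^{-1/2}` from `θ*`, and near `θ*` the excess
risk is comparable to the squared distance. No limit law for the estimator is needed.

Upper bound. At `θ*` the two class gradients are opposite, so `∇R̃(θ*)` equals `(n₀ - n₁ - m)/N`
times the majority gradient plus `π̃ ∇ψ(θ*)`; balancing and the ideal generator make both terms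
`o(n₀^{-1/2})`. Hoeffding's inequality and chaining over `Θ` (`LossBounds.exists_sup_deviation`)
bound the distance from the empirical gradient to `∇R̃` by `O_P(n₀^{-1/2})`, uniformly in `θ`. As
`R̃` is uniformly strongly convex, the empirical risk then has minimizers with high probability, all
within `C/√n₀` of `θ*` (`exists_localization`). The gradient of `R` vanishes at `θ*` and is
Lipschitz, so the excess risk is `O_P(n₀⁻¹)`.

Lower bound. The total score vanishes at the minimizer, so by the Lipschitz bound the total score at
`θ*` has norm at most `N K ‖θhat - θ*‖`, with `N ≤ 3 n₀`. By the central limit theorem the majority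
scores alone keep it from concentrating below the scale `√n₀`, whatever the independent remaining
summands are (`exists_score_anticoncentration`). Hence `‖θhat - θ*‖` is at least of order
`n₀^{-1/2}`, and quadratic growth of `R` concludes. The nondegeneracy of the scores, given at `θ̃`,
passes to `θ*` because `θ̃ → θ*`. -/

/-! ### Dyadic nets and chaining -/

/-- In finite dimension a bounded set has inner nets of radius `≍ 2⁻ʲ` and cardinality at
most `M ^ j`. -/
theorem Bornology.IsBounded.exists_dyadic_nets {E : Type*} [NormedAddCommGroup E]
    [NormedSpace ℝ E] [FiniteDimensional ℝ E] {S : Set E} (hS : Bornology.IsBounded S) :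
    ∃ D : ℝ, 0 < D ∧ ∃ M : ℕ, 0 < M ∧ ∀ j : ℕ, ∃ F : Finset E, (↑F ⊆ S) ∧ F.card ≤ M ^ j ∧
      ∀ θ ∈ S, ∃ a ∈ F, ‖a - θ‖ ≤ D * (1 / 2) ^ j := by
  classical
  obtain ⟨R, hR, hSR⟩ := hS.exists_pos_norm_le
  have hcomp : IsCompact (Metric.closedBall (0 : E) 1) := isCompact_closedBall _ _
  obtain ⟨T, hTf, hT⟩ := Metric.totallyBounded_iff.1 hcomp.totallyBounded (1 / 2) (by norm_num)
  set G : Finset E := hTf.toFinset with hG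
  have hGcov : ∀ x : E, ‖x‖ ≤ 1 → ∃ y ∈ G, ‖x - y‖ ≤ 1 / 2 := by
    intro x hx
    have := hT (show x ∈ Metric.closedBall (0 : E) 1 by simpa using hx)
    simp only [Set.mem_iUnion] at this
    obtain ⟨y, hy, hxy⟩ := this
    exact ⟨y, by simpa [hG] using hy, by simpa [dist_eq_norm] using (Metric.mem_ball.1 hxy).le⟩
  -- Each ball of radius `r` is covered by `G.card` balls of radius `r / 2`, by rescaling the cover
  -- `G` of the unit ball.
  have houter : ∀ j : ℕ, ∃ F : Finset E, F.card ≤ G.card ^ j ∧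
      ∀ θ : E, ‖θ‖ ≤ R → ∃ a ∈ F, ‖θ - a‖ ≤ R * (1 / 2) ^ j := by
    intro j
    induction j with
    | zero => exact ⟨{0}, by simp, fun θ h => ⟨0, by simp, by simpa using h⟩⟩
    | succ j ih =>
      obtain ⟨F, hF, hcov⟩ := ih
      set r : ℝ := R * (1 / 2) ^ j with hr
      have hrpos : 0 < r := by positivity
      refine ⟨(F ×ˢ G).image fun q => q.1 + r • q.2, ?_, ?_⟩
      · refine Finset.card_image_le.trans ?_
        rw [Finset.card_product, pow_succ]
        gcongr
      · intro θ hθ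
        obtain ⟨a, ha, hθa⟩ := hcov θ hθ
        obtain ⟨y, hy, hxy⟩ := hGcov (r⁻¹ • (θ - a)) (by
          rw [norm_smul, norm_inv, Real.norm_of_nonneg hrpos.le]
          rw [inv_mul_le_iff₀ hrpos]; simpa using hθa)
        refine ⟨a + r • y, Finset.mem_image.2 ⟨(a, y), by simp [ha, hy], rfl⟩, ?_⟩
        have : θ - (a + r • y) = r • (r⁻¹ • (θ - a) - y) := by
          rw [smul_sub, smul_inv_smul₀ hrpos.ne']; abel
        rw [this, norm_smul, Real.norm_of_nonneg hrpos.le]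
        calc r * ‖r⁻¹ • (θ - a) - y‖ ≤ r * (1 / 2) := by gcongr
          _ = R * (1 / 2) ^ (j + 1) := by rw [hr]; ring
  have hGpos : 0 < G.card := by
    obtain ⟨y, hy, -⟩ := hGcov 0 (by simp)
    exact Finset.card_pos.2 ⟨y, hy⟩
  refine ⟨2 * R, by positivity, G.card, hGpos, fun j => ?_⟩
  obtain ⟨F, hF, hcov⟩ := houter j
  -- The centres found so far may lie outside `S`. Those with a nearby point of `S` are replaced by
  -- such a point, which doubles the radius; the value `0` for the others is never used.
  have hsel : ∀ a : E, ∃ b : E, (∃ θ ∈ S, ‖θ - a‖ ≤ R * (1 / 2) ^ j) →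
      b ∈ S ∧ ‖b - a‖ ≤ R * (1 / 2) ^ j := by
    intro a
    by_cases h : ∃ θ ∈ S, ‖θ - a‖ ≤ R * (1 / 2) ^ j
    · obtain ⟨θ, h1, h2⟩ := h
      exact ⟨θ, fun _ => ⟨h1, h2⟩⟩
    · exact ⟨0, fun h' => absurd h' h⟩
  choose b hb using hsel
  refine ⟨(F.filter fun a => ∃ θ ∈ S, ‖θ - a‖ ≤ R * (1 / 2) ^ j).image b, ?_, ?_, ?_⟩
  · intro x hx
    obtain ⟨a, ha, rfl⟩ := Finset.mem_image.1 (Finset.mem_coe.1 hx)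
    exact (hb a (Finset.mem_filter.1 ha).2).1
  · exact Finset.card_image_le.trans ((Finset.card_filter_le _ _).trans hF)
  · intro θ hθ
    obtain ⟨a, ha, hθa⟩ := hcov θ (hSR θ hθ)
    refine ⟨b a, Finset.mem_image_of_mem _ (Finset.mem_filter.2 ⟨ha, θ, hθ, hθa⟩), ?_⟩
    have h1 := (hb a ⟨θ, hθ, hθa⟩).2
    calc ‖b a - θ‖ = ‖(b a - a) - (θ - a)‖ := by congr 1; abel
      _ ≤ ‖b a - a‖ + ‖θ - a‖ := norm_sub_le _ _
      _ ≤ 2 * R * (1 / 2) ^ j := by linarith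

/-- **Chaining.** A process with sub-Gaussian increments on a bounded subset of a
finite-dimensional space has a supremum that is bounded in probability, uniformly over all such
processes. -/
theorem exists_sup_bound_of_subgaussian_increments.{u} {E : Type*} [NormedAddCommGroup E]
    [NormedSpace ℝ E] [FiniteDimensional ℝ E] {S : Set E} (hS : Bornology.IsBounded S)
    {θ₀ : E} (hθ₀ : θ₀ ∈ S) {K : ℝ} (hK : 0 < K) {ε : ℝ} (hε : 0 < ε) :
    ∃ A : ℝ, 0 < A ∧ ∀ (Ω : Type u) [MeasurableSpace Ω] (μ : Measure Ω) (W : E → Ω → ℝ),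
      (∀ᵐ ω ∂μ, ContinuousOn (fun θ => W θ ω) S) →
      (∀ a ∈ S, ∀ b ∈ S, ∀ s : ℝ, 0 ≤ s → μ {ω | s * ‖a - b‖ < |W a ω - W b ω|}
        ≤ ENNReal.ofReal (2 * Real.exp (-s ^ 2 / (2 * K ^ 2)))) →
      μ {ω | ∃ θ ∈ S, A < |W θ ω - W θ₀ ω|} ≤ ENNReal.ofReal ε := by
  obtain ⟨D, hD, M, hM, hnet⟩ := hS.exists_dyadic_nets
  choose F hFS hFcard hFcov using hnet
  have hexp : Tendsto (fun A : ℝ => Real.exp (-A ^ 2 / (2 * K ^ 2))) atTop (𝓝 0) := by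
    refine Real.tendsto_exp_atBot.comp ?_
    simp_rw [neg_div]
    refine tendsto_neg_atTop_atBot.comp ?_
    exact (tendsto_pow_atTop two_ne_zero).atTop_div_const (by positivity)
  have hMR : (0 : ℝ) < M := by exact_mod_cast hM
  -- There are at most `M (M²)ʲ` pairs between levels `j` and `j + 1`. Since `(A + B j)² ≥ A² + j
  -- B²`, `B` beats the growth `M²` and `A` the prefactor, leaving failure probability `ε/2 · 2⁻ʲ`
  -- at level `j`.
  obtain ⟨A, hA1, hA0⟩ := (((hexp.const_mul (4 * (M : ℝ))).eventually_le_const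
    (by simpa using hε)).and (eventually_ge_atTop (0 : ℝ))).exists
  obtain ⟨B, hB1, hB0⟩ := (((hexp.const_mul ((M : ℝ) ^ 2)).eventually_le_const
    (show (M : ℝ) ^ 2 * 0 < 1 / 2 by norm_num)).and (eventually_ge_atTop (0 : ℝ))).exists
  set s : ℕ → ℝ := fun j => A + B * j with hs
  have hs0 : ∀ j, 0 ≤ s j := fun j => by positivity
  have hsum : Summable fun j : ℕ => s j * (2 * D * (1 / 2) ^ j) := by
    have h0 : Summable fun j : ℕ => ((1 : ℝ) / 2) ^ j := summable_geometric_two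
    have h1 : Summable fun j : ℕ => (j : ℝ) ^ 1 * ((1 : ℝ) / 2) ^ j :=
      summable_pow_mul_geometric_of_norm_lt_one 1 (by norm_num)
    refine ((h0.mul_left (2 * D * A)).add (h1.mul_left (2 * D * B))).congr fun j => ?_
    simp only [hs]; ring
  set V : ℝ := ∑' j, s j * (2 * D * (1 / 2) ^ j) with hV
  have hV0 : 0 ≤ V := tsum_nonneg fun j => by have := hs0 j; positivity
  -- Both `θ` and `θ₀` are compared with the root of the chains, each at cost `V`.
  refine ⟨2 * V + 1, by positivity, fun Ω _ μ W hcont htail => ?_⟩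
  set bad : ℕ → Set Ω := fun j => ⋃ a ∈ F j, ⋃ b ∈ F (j + 1),
    {ω | s j * ‖a - b‖ < |W a ω - W b ω|} with hbad
  have hbadj : ∀ j, μ (bad j) ≤ ENNReal.ofReal (ε / 2 * (1 / 2) ^ j) := by
    intro j
    have h1 : μ (bad j) ≤ ∑ a ∈ F j, ∑ b ∈ F (j + 1),
        ENNReal.ofReal (2 * Real.exp (-(s j) ^ 2 / (2 * K ^ 2))) := by
      refine (measure_biUnion_finset_le _ _).trans (Finset.sum_le_sum fun a ha => ?_)
      refine (measure_biUnion_finset_le _ _).trans (Finset.sum_le_sum fun b hb => ?_)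
      exact htail a (hFS _ ha) b (hFS _ hb) _ (hs0 j)
    refine h1.trans ?_
    rw [Finset.sum_const, Finset.sum_const, smul_smul, nsmul_eq_mul,
      ← ENNReal.ofReal_natCast, ← ENNReal.ofReal_mul (by positivity)]
    refine ENNReal.ofReal_le_ofReal ?_
    have hcard : ((F j).card * (F (j + 1)).card : ℕ) ≤ ((M : ℝ) * (M ^ 2) ^ j) := by
      have : (F j).card * (F (j + 1)).card ≤ M ^ j * M ^ (j + 1) :=
        Nat.mul_le_mul (hFcard j) (hFcard (j + 1))
      calc (((F j).card * (F (j + 1)).card : ℕ) : ℝ) ≤ ((M ^ j * M ^ (j + 1) : ℕ) : ℝ) := by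
            exact_mod_cast this
        _ = (M : ℝ) * (M ^ 2) ^ j := by push_cast; ring
    have hss : A ^ 2 + j * B ^ 2 ≤ (s j) ^ 2 := by
      have hj : (j : ℝ) ≤ (j : ℝ) ^ 2 := by exact_mod_cast Nat.le_self_pow two_ne_zero j
      have : 0 ≤ A * B * j := by positivity
      simp only [hs]
      nlinarith [mul_le_mul_of_nonneg_right hj (sq_nonneg B)]
    have hex : Real.exp (-(s j) ^ 2 / (2 * K ^ 2))
        ≤ Real.exp (-A ^ 2 / (2 * K ^ 2)) * Real.exp (-B ^ 2 / (2 * K ^ 2)) ^ j := by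
      rw [← Real.exp_nat_mul, ← Real.exp_add, Real.exp_le_exp, mul_div_assoc', ← add_div]
      gcongr
      nlinarith
    calc (((F j).card * (F (j + 1)).card : ℕ) : ℝ) * (2 * Real.exp (-(s j) ^ 2 / (2 * K ^ 2)))
        ≤ ((M : ℝ) * (M ^ 2) ^ j) * (2 * (Real.exp (-A ^ 2 / (2 * K ^ 2))
            * Real.exp (-B ^ 2 / (2 * K ^ 2)) ^ j)) := by gcongr
      _ = (4 * M * Real.exp (-A ^ 2 / (2 * K ^ 2))) / 2
            * (M ^ 2 * Real.exp (-B ^ 2 / (2 * K ^ 2))) ^ j := by rw [mul_pow]; ring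
      _ ≤ ε / 2 * (1 / 2) ^ j := by gcongr
  have hbadU : μ (⋃ j, bad j) ≤ ENNReal.ofReal ε := by
    refine (measure_iUnion_le _).trans ((ENNReal.tsum_le_tsum hbadj).trans_eq ?_)
    rw [← ENNReal.ofReal_tsum_of_nonneg (fun j => by positivity)
      (summable_geometric_two.mul_left _), tsum_mul_left, tsum_geometric_two]
    congr 1; ring
  refine (measure_mono_ae ?_).trans hbadU
  filter_upwards [hcont] with ω hω
  intro hex
  by_contra hgood
  have hgood' : ∀ j, ∀ a ∈ F j, ∀ b ∈ F (j + 1), |W a ω - W b ω| ≤ s j * ‖a - b‖ := by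
    intro j a ha b hb
    by_contra hlt
    exact hgood (Set.mem_iUnion.2 ⟨j, by
      simp only [hbad, Set.mem_iUnion]
      exact ⟨a, ha, b, hb, not_le.1 hlt⟩⟩)
  -- The level-zero net has at most `M ^ 0 = 1` point, so all chains share one root.
  obtain ⟨a₀, ha₀⟩ : ∃ a₀, ∀ a ∈ F 0, a = a₀ := by
    have := hFcard 0
    rw [pow_zero, Finset.card_le_one] at this
    by_cases hne : (F 0).Nonempty
    · exact ⟨hne.choose, fun a ha => this a ha _ hne.choose_spec⟩
    · exact ⟨0, fun a ha => absurd ⟨a, ha⟩ hne⟩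
  have hkey : ∀ θ ∈ S, |W θ ω - W a₀ ω| ≤ V := by
    intro θ hθ
    choose q hqF hqd using fun j => hFcov j θ hθ
    have hq0 : q 0 = a₀ := ha₀ _ (hqF 0)
    have hstep : ∀ j, |W (q (j + 1)) ω - W (q j) ω| ≤ s j * (2 * D * (1 / 2) ^ j) := by
      intro j
      rw [abs_sub_comm]
      refine (hgood' j _ (hqF j) _ (hqF (j + 1))).trans ?_
      refine mul_le_mul_of_nonneg_left ?_ (hs0 j)
      calc ‖q j - q (j + 1)‖ = ‖(q j - θ) - (q (j + 1) - θ)‖ := by congr 1; abel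
        _ ≤ ‖q j - θ‖ + ‖q (j + 1) - θ‖ := norm_sub_le _ _
        _ ≤ D * (1 / 2) ^ j + D * (1 / 2) ^ (j + 1) := add_le_add (hqd j) (hqd (j + 1))
        _ ≤ 2 * D * (1 / 2) ^ j := by
          have : (0 : ℝ) < D * (1 / 2) ^ j := by positivity
          rw [pow_succ]; linarith
    have hpart : ∀ J, |W (q J) ω - W a₀ ω| ≤ V := by
      intro J
      have htel : W (q J) ω - W a₀ ω = ∑ j ∈ Finset.range J, (W (q (j + 1)) ω - W (q j) ω) := by
        rw [Finset.sum_range_sub (fun j => W (q j) ω), hq0]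
      rw [htel]
      refine (Finset.abs_sum_le_sum_abs _ _).trans ((Finset.sum_le_sum fun j _ => hstep j).trans ?_)
      exact hsum.sum_le_tsum _ fun j _ => by have := hs0 j; positivity
    have hqlim : Tendsto q atTop (𝓝[S] θ) := by
      refine tendsto_nhdsWithin_iff.2 ⟨?_, Eventually.of_forall fun j => hFS j (hqF j)⟩
      rw [tendsto_iff_norm_sub_tendsto_zero]
      refine squeeze_zero (fun _ => norm_nonneg _) hqd ?_
      simpa using (tendsto_pow_atTop_nhds_zero_of_lt_one (r := (1 / 2 : ℝ))
        (by norm_num) (by norm_num)).const_mul D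
    -- Continuity of the path carries the bound from the nets to every point of `S`.
    exact le_of_tendsto (((hω θ hθ).tendsto.comp hqlim).sub_const (W a₀ ω)).abs
      (Eventually.of_forall hpart)
  obtain ⟨θ, hθ, hlt⟩ := hex
  have h1 := hkey θ hθ
  have h2 := hkey θ₀ hθ₀
  have h3 : |W θ ω - W θ₀ ω| ≤ |W θ ω - W a₀ ω| + |W θ₀ ω - W a₀ ω| := by
    calc |W θ ω - W θ₀ ω| = |(W θ ω - W a₀ ω) - (W θ₀ ω - W a₀ ω)| := by congr 1; ring
      _ ≤ _ := abs_sub _ _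
  linarith

/-! ### Hoeffding's inequality -/

/-- A two-sided **Hoeffding inequality** for normalized sums of independent bounded variables. -/
theorem measure_abs_normalized_sum_gt_le {Ω ι : Type*} [MeasurableSpace Ω] [Fintype ι]
    {μ : Measure Ω} [IsProbabilityMeasure μ] {Y : ι → Ω → ℝ} (hind : iIndepFun Y μ)
    (hmeas : ∀ i, AEMeasurable (Y i) μ) {b : ℝ} (hb : 0 < b) (hbd : ∀ i, ∀ᵐ ω ∂μ, |Y i ω| ≤ b)
    (hn : 0 < Fintype.card ι) {s : ℝ} (hs : 0 ≤ s) :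
    μ {ω | s * b < |(√(Fintype.card ι : ℝ))⁻¹ * ∑ i, (Y i ω - ∫ ω, Y i ω ∂μ)|}
      ≤ ENNReal.ofReal (2 * Real.exp (-s ^ 2 / 2)) := by
  set n : ℝ := (Fintype.card ι : ℝ) with hndef
  have hnpos : 0 < n := Nat.cast_pos.2 hn
  have hsub : ∀ i, HasSubgaussianMGF (fun ω => Y i ω - ∫ ω, Y i ω ∂μ)
      ((‖b - (-b)‖₊ / 2) ^ 2) μ := fun i =>
    hasSubgaussianMGF_of_mem_Icc (hmeas i) ((hbd i).mono fun ω h => abs_le.1 h)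
  have hind' : iIndepFun (fun i ω => Y i ω - ∫ ω, Y i ω ∂μ) μ :=
    hind.comp (fun i x => x - ∫ ω, Y i ω ∂μ) fun i => by fun_prop
  have hsumG := HasSubgaussianMGF.sum_of_iIndepFun hind' (s := Finset.univ) fun i _ => hsub i
  -- A variable in `[-b, b]` has variance proxy `b²`; the proxies of independent summands add up.
  have hc : ((∑ _i : ι, (‖b - (-b)‖₊ / 2) ^ 2 : NNReal) : ℝ) = n * b ^ 2 := by
    simp only [Finset.sum_const, Finset.card_univ, nsmul_eq_mul]
    push_cast
    rw [Real.norm_of_nonneg (by linarith)]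
    ring
  have hr : 0 ≤ s * b * √n := by positivity
  have hexp : Real.exp (-(s * b * √n) ^ 2 / (2 * (n * b ^ 2))) = Real.exp (-s ^ 2 / 2) := by
    congr 1
    rw [mul_pow, Real.sq_sqrt hnpos.le]
    field_simp
  have h1 := hsumG.measure_ge_le hr
  have h2 := hsumG.neg.measure_ge_le hr
  rw [hc, hexp] at h1 h2
  set Z : Ω → ℝ := fun ω => ∑ i, (Y i ω - ∫ ω, Y i ω ∂μ) with hZ
  have hsubset : {ω | s * b < |(√n)⁻¹ * Z ω|} ⊆
      {ω | s * b * √n ≤ Z ω} ∪ {ω | s * b * √n ≤ (-Z) ω} := by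
    intro ω hω
    have hsq : 0 < √n := Real.sqrt_pos.2 hnpos
    simp only [Set.mem_ofPred_eq, abs_mul, abs_inv, abs_of_pos hsq] at hω
    rw [lt_inv_mul_iff₀ hsq] at hω
    rcases le_abs.1 hω.le with h | h
    · exact Or.inl (by simpa [mul_comm] using h)
    · exact Or.inr (by simpa [mul_comm] using h)
  refine (measure_mono hsubset).trans ((measure_union_le _ _).trans ?_)
  rw [two_mul, ENNReal.ofReal_add (Real.exp_pos _).le (Real.exp_pos _).le]
  refine add_le_add ?_ ?_
  · rw [← ofReal_measureReal]; exact ENNReal.ofReal_le_ofReal h1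
  · rw [← ofReal_measureReal]; exact ENNReal.ofReal_le_ofReal h2

/-! ### Anti-concentration of independent sums -/

/-- Short intervals have small Gaussian measure, uniformly in their position. -/
theorem exists_gaussianReal_Icc_le {v : NNReal} (hv : v ≠ 0) {ε : ℝ} (hε : 0 < ε) :
    ∃ h : ℝ, 0 < h ∧ ∀ a : ℝ, gaussianReal 0 v (Set.Icc a (a + h)) ≤ ENNReal.ofReal ε := by
  -- `C` is the maximum of the Gaussian density.
  set C : ℝ := (√(2 * Real.pi * v))⁻¹ with hC
  have hvpos : (0 : ℝ) < v := by exact_mod_cast pos_iff_ne_zero.2 hv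
  have hCpos : 0 < C := by positivity
  refine ⟨ε / C, by positivity, fun a => ?_⟩
  rw [gaussianReal_apply _ hv]
  calc ∫⁻ x in Set.Icc a (a + ε / C), gaussianPDF 0 v x
      ≤ ∫⁻ _ in Set.Icc a (a + ε / C), ENNReal.ofReal C := by
        refine lintegral_mono fun x => ENNReal.ofReal_le_ofReal ?_
        rw [gaussianPDFReal]
        refine mul_le_of_le_one_right hCpos.le (Real.exp_le_one_iff.2 ?_)
        rw [neg_div]
        exact neg_nonpos.2 (by positivity)
    _ = ENNReal.ofReal ε := by
        rw [setLIntegral_const, Real.volume_Icc, ← ENNReal.ofReal_mul hCpos.le]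
        congr 1
        field_simp
        ring

/-- **Anti-concentration.** A sum of `n` i.i.d. non-degenerate square integrable variables puts
little mass on each interval of length `c √n`, uniformly in the position of the interval. -/
theorem exists_anticoncentration {ν : Measure ℝ} [IsProbabilityMeasure ν] (h2 : MemLp id 2 ν)
    (hv : Var[id; ν] ≠ 0) {ε : ℝ} (hε : 0 < ε) :
    ∃ c : ℝ, 0 < c ∧ ∀ᶠ n : ℕ in atTop, ∀ t : ℝ,
      Measure.pi (fun _ : Fin n => ν) {y | |∑ i, y i - t| < c * √n} ≤ ENNReal.ofReal ε := by
  set P : Measure (ℕ → ℝ) := Measure.infinitePi fun _ => ν with hP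
  set X : ℕ → (ℕ → ℝ) → ℝ := fun i x => x i with hX
  have hlaw : ∀ i, P.map (X i) = ν := fun i => Measure.infinitePi_map_eval _ i
  have hXm : ∀ i, Measurable (X i) := fun i => measurable_pi_apply i
  have hident : ∀ i, IdentDistrib (X i) (X 0) P P := fun i =>
    ⟨(hXm i).aemeasurable, (hXm 0).aemeasurable, by rw [hlaw, hlaw]⟩
  have hindep : iIndepFun X P := iIndepFun_infinitePi (X := fun _ => id) fun _ => measurable_id
  have hvar : Var[X 0; P] = Var[id; ν] := by
    rw [← hlaw 0, variance_map (by fun_prop) (hXm 0).aemeasurable]; rfl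
  have hmem : MemLp (X 0) 2 P := by
    rw [← hlaw 0] at h2
    exact (memLp_map_measure_iff h2.1 (hXm 0).aemeasurable).1 h2
  set v : NNReal := Var[X 0; P].toNNReal with hvdef
  have hv0 : v ≠ 0 := by
    rw [hvdef, hvar, Ne, Real.toNNReal_eq_zero, not_le]
    exact lt_of_le_of_ne (variance_nonneg _ _) (Ne.symm hv)
  have hclt := (tendstoInDistribution_inv_sqrt_mul_sum_sub (Y := id)
    (P' := gaussianReal 0 v) ⟨aemeasurable_id, Measure.map_id⟩ hmem hindep hident)
  set Z : ℕ → (ℕ → ℝ) → ℝ := fun n ω => (√n)⁻¹ * (∑ k ∈ Finset.range n, X k ω - n * P[X 0])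
    with hZ
  have hZm : ∀ n, Measurable (Z n) := fun n => by fun_prop
  -- Portmanteau bounds the limsup on closed sets; the slack from `ε / 4` to `ε / 2` turns this into
  -- an eventual bound.
  have hclosed : ∀ F : Set ℝ, IsClosed F → gaussianReal 0 v F ≤ ENNReal.ofReal (ε / 4) →
      ∀ᶠ n in atTop, P (Z n ⁻¹' F) ≤ ENNReal.ofReal (ε / 2) := by
    intro F hF hle
    have hls := ProbabilityMeasure.limsup_measure_closed_le_of_tendsto hclt.tendsto hF
    have hlt := lt_of_le_of_lt (hls.trans (by simpa [Measure.map_id] using hle))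
      ((ENNReal.ofReal_lt_ofReal_iff (by positivity)).2 (show ε / 4 < ε / 2 by linarith))
    filter_upwards [eventually_lt_of_limsup_lt hlt] with n hn
    rw [← Measure.map_apply (hZm n) hF.measurableSet]
    exact hn.le
  obtain ⟨h, hh, hIcc⟩ := exists_gaussianReal_Icc_le hv0 (show 0 < ε / 4 by positivity)
  -- If `j c ≤ t' < (j + 1) c`, the points within `c` of `t'` lie in `[(j - 1) c, (j + 2) c]`, of
  -- length `3 c = h`.
  set c : ℝ := h / 3 with hc
  have hcpos : 0 < c := by positivity
  -- Chosen so that Chebyshev's bound `v / M²` is at most `ε / 4`.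
  set M : ℝ := √(4 * v / ε) + 1 with hM
  have hMpos : 0 < M := by positivity
  have htail : gaussianReal 0 v {x | M ≤ |x|} ≤ ENNReal.ofReal (ε / 4) := by
    have := meas_ge_le_variance_div_sq (memLp_id_gaussianReal (μ := 0) (v := v) 2) hMpos
    simp only [id, integral_id_gaussianReal, sub_zero] at this
    rw [variance_id_gaussianReal] at this
    refine this.trans (ENNReal.ofReal_le_ofReal ?_)
    rw [div_le_iff₀ (by positivity)]
    have : 4 * v / ε ≤ M ^ 2 := by
      rw [hM, add_sq, Real.sq_sqrt (by positivity)]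
      have := Real.sqrt_nonneg (4 * v / ε)
      linarith
    rw [div_le_iff₀ hε] at this
    linarith
  have hevtail := hclosed {x | M ≤ |x|} (isClosed_le continuous_const continuous_abs) htail
  -- Uniformity in `t`: only finitely many grid intervals are needed, since a cell index outside
  -- `[-J, J]` forces `|Z n| ≥ M`. The margin `1` absorbs the distance `c` from `Z n` to `t'`.
  set J : ℤ := ⌈M / c⌉ + 1 with hJ
  have hJM : M ≤ (J - 1 : ℝ) * c := by
    have := Int.le_ceil (M / c)
    rw [div_le_iff₀ hcpos] at this
    simpa [hJ] using this
  have hevgrid : ∀ᶠ n in atTop, ∀ j ∈ Finset.Icc (-J) J,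
      P (Z n ⁻¹' Set.Icc ((j - 1 : ℝ) * c) ((j - 1 : ℝ) * c + h)) ≤ ENNReal.ofReal (ε / 2) := by
    rw [Filter.eventually_all_finset]
    exact fun j _ => hclosed _ isClosed_Icc (hIcc _)
  refine ⟨c, hcpos, ?_⟩
  filter_upwards [hevtail, hevgrid, eventually_gt_atTop 0] with n hn1 hn2 hn0 t
  have hsq : 0 < √(n : ℝ) := Real.sqrt_pos.2 (by exact_mod_cast hn0)
  have hpi : P.map (fun ω (i : Fin n) => ω i) = Measure.pi fun _ : Fin n => ν := by
    have := (iIndepFun_iff_map_fun_eq_pi_map (f := fun (i : Fin n) => X i)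
      fun i => (hXm i).aemeasurable).1 (hindep.precomp Fin.val_injective)
    simpa only [hlaw] using this
  have hmeas : MeasurableSet {y : Fin n → ℝ | |∑ i, y i - t| < c * √n} :=
    measurableSet_lt (by fun_prop) measurable_const
  rw [← hpi, Measure.map_apply (by fun_prop) hmeas]
  set t' : ℝ := (√n)⁻¹ * (t - n * P[X 0]) with ht'
  have hclose : ∀ ω ∈ (fun ω (i : Fin n) => ω i) ⁻¹' {y : Fin n → ℝ | |∑ i, y i - t| < c * √n},
      |Z n ω - t'| < c := by
    intro ω hω
    simp only [Set.mem_preimage, Set.mem_ofPred_eq] at hω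
    have h1 : Z n ω - t' = (√n)⁻¹ * (∑ i : Fin n, ω i - t) := by
      rw [hZ, ht', Fin.sum_univ_eq_sum_range (fun i => ω i) n]
      ring
    rw [h1, abs_mul, abs_inv, abs_of_pos hsq, inv_mul_lt_iff₀ hsq, mul_comm]
    exact hω
  set j : ℤ := ⌊t' / c⌋ with hj
  have hj1 : (j : ℝ) * c ≤ t' := (le_div_iff₀ hcpos).1 (Int.floor_le _)
  have hj2 : t' < (j + 1 : ℝ) * c := (div_lt_iff₀ hcpos).1 (Int.lt_floor_add_one _)
  have hlast : ENNReal.ofReal (ε / 2) ≤ ENNReal.ofReal ε :=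
    ENNReal.ofReal_le_ofReal (by linarith)
  by_cases hjJ : j ∈ Finset.Icc (-J) J
  · refine (measure_mono fun ω hω => ?_).trans ((hn2 j hjJ).trans hlast)
    have := abs_lt.1 (hclose ω hω)
    refine ⟨by linarith [this.1], ?_⟩
    have hh3 : h = 3 * c := by rw [hc]; ring
    linarith [this.2]
  · refine (measure_mono fun ω hω => ?_).trans (hn1.trans hlast)
    have := abs_lt.1 (hclose ω hω)
    rw [Finset.mem_Icc, not_and_or, not_le, not_le] at hjJ
    show M ≤ |Z n ω|
    rcases hjJ with hlt | hlt
    · have : (j : ℝ) + 1 ≤ -J := by exact_mod_cast hlt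
      have := mul_le_mul_of_nonneg_right this hcpos.le
      exact le_abs.2 (Or.inr (by linarith))
    · have : (J : ℝ) + 1 ≤ j := by exact_mod_cast hlt
      have := mul_le_mul_of_nonneg_right this hcpos.le
      exact le_abs.2 (Or.inl (by linarith))

/-- Adding an independent variable does not increase the concentration of an i.i.d. sum. -/
theorem measure_abs_sum_add_lt_le {Ω κ : Type*} [MeasurableSpace Ω] [Fintype κ]
    {μ : Measure Ω} {n : ℕ} {Y : Fin n ⊕ κ → Ω → ℝ} {ν : Measure ℝ} [IsProbabilityMeasure ν]
    (hind : iIndepFun Y μ) (hmeas : ∀ i, Measurable (Y i)) (hlaw : ∀ i, μ.map (Y (Sum.inl i)) = ν)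
    {r : ℝ} {δ : ENNReal}
    (hconc : ∀ t : ℝ, Measure.pi (fun _ : Fin n => ν) {y | |∑ i, y i - t| < r} ≤ δ) :
    μ {ω | |∑ i, Y i ω| < r} ≤ δ := by
  classical
  have : IsProbabilityMeasure μ := hind.isProbabilityMeasure
  set A : Ω → Fin n → ℝ := fun ω i => Y (Sum.inl i) ω with hA
  set T : Ω → ℝ := fun ω => ∑ k, Y (Sum.inr k) ω with hT
  have hAm : Measurable A := measurable_pi_lambda _ fun i => hmeas _
  have hTm : Measurable T := Finset.measurable_fun_sum _ fun k _ => hmeas _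
  have hpi : μ.map A = Measure.pi fun _ : Fin n => ν := by
    have := (iIndepFun_iff_map_fun_eq_pi_map (f := fun (i : Fin n) => Y (Sum.inl i))
      fun i => (hmeas _).aemeasurable).1 (hind.precomp Sum.inl_injective)
    simpa only [hlaw] using this
  have hAT : IndepFun A T μ := by
    set S₁ : Finset (Fin n ⊕ κ) := Finset.univ.map ⟨Sum.inl, Sum.inl_injective⟩
    set S₂ : Finset (Fin n ⊕ κ) := Finset.univ.map ⟨Sum.inr, Sum.inr_injective⟩
    have hdisj : Disjoint S₁ S₂ := by
      rw [Finset.disjoint_left]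
      simp [S₁, S₂]
    have h := hind.indepFun_finset S₁ S₂ hdisj hmeas
    exact h.comp (φ := fun (y : S₁ → ℝ) (i : Fin n) => y ⟨Sum.inl i, by simp [S₁]⟩)
      (ψ := fun (y : S₂ → ℝ) => ∑ k : κ, y ⟨Sum.inr k, by simp [S₂]⟩)
      (by fun_prop) (by fun_prop)
  have hprod := (indepFun_iff_map_prod_eq_prod_map_map hAm.aemeasurable hTm.aemeasurable).1 hAT
  set B : Set ((Fin n → ℝ) × ℝ) := {q | |∑ i, q.1 i + q.2| < r} with hB
  have hBm : MeasurableSet B := measurableSet_lt (by fun_prop) measurable_const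
  have hpre : {ω | |∑ i, Y i ω| < r} = (fun ω => (A ω, T ω)) ⁻¹' B := by
    ext ω
    simp [hB, hA, hT, Fintype.sum_sum_type]
  have := Measure.isProbabilityMeasure_map (μ := μ) hTm.aemeasurable
  -- Conditionally on `T = t`, the event says that the i.i.d. sum is within `r` of `-t`; the bound
  -- is uniform in `t` and integrates.
  rw [hpre, ← Measure.map_apply (hAm.prodMk hTm) hBm, hprod, hpi, Measure.prod_apply_symm hBm]
  calc ∫⁻ t, Measure.pi (fun _ : Fin n => ν) ((fun y => (y, t)) ⁻¹' B) ∂(μ.map T)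
      ≤ ∫⁻ _, δ ∂(μ.map T) := by
        refine lintegral_mono fun t => ?_
        have := hconc (-t)
        simpa [hB] using this
    _ = δ := by simp

section
variable {d p : ℕ}

/-! ### The gradient of the loss and of the class risks -/

/-- The gradient `∇_θ ℓ(θ; x, y)` of the loss. -/
noncomputable def lossGrad (ℓ : Vec d → Vec p → Fin 2 → ℝ) (θ : Vec d) (x : Vec p) (y : Fin 2) :
    Vec d :=
  ∇ (fun θ' => ℓ θ' x y) θ

/-- The mean gradient `E_P ∇_θ ℓ(θ; x, y)`. -/
noncomputable def meanGrad (ℓ : Vec d → Vec p → Fin 2 → ℝ) (P : Measure (Vec p)) (y : Fin 2)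
    (θ : Vec d) : Vec d :=
  ∫ x, lossGrad ℓ θ x y ∂P

/-- `K` bounds the loss and its gradient, and is a Lipschitz constant of the gradient, uniformly
for covariates in the ball of radius `r`. -/
structure LossBounds (Θ : Set (Vec d)) (ℓ : Vec d → Vec p → Fin 2 → ℝ) (r K : ℝ) : Prop where
  pos : 0 < K
  value : ∀ θ ∈ Θ, ∀ x, ‖x‖ ≤ r → ∀ y, |ℓ θ x y| ≤ K
  grad : ∀ θ ∈ Θ, ∀ x, ‖x‖ ≤ r → ∀ y, ‖lossGrad ℓ θ x y‖ ≤ K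
  grad_lipschitz : ∀ θ ∈ Θ, ∀ θ' ∈ Θ, ∀ x, ‖x‖ ≤ r → ∀ y,
    ‖lossGrad ℓ θ x y - lossGrad ℓ θ' x y‖ ≤ K * ‖θ - θ'‖

section
variable {Θ : Set (Vec d)} {ℓ : Vec d → Vec p → Fin 2 → ℝ}

theorem LossRegular.hasGradientAt (hreg : LossRegular Θ ℓ) {θ : Vec d} (hθ : θ ∈ Θ) (x : Vec p)
    (y : Fin 2) : HasGradientAt (fun θ' => ℓ θ' x y) (lossGrad ℓ θ x y) θ :=
  (hreg.differentiable θ hθ x y).hasGradientAt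

/-- The Hessian bound becomes a Lipschitz bound for the gradient by the mean value inequality on the
convex set `Θ`. -/
theorem LossRegular.exists_lossBounds (hreg : LossRegular Θ ℓ) (r : ℝ) :
    ∃ K, LossBounds Θ ℓ r K := by
  obtain ⟨K, hK⟩ := hreg.bounded_on_bounded r
  have hle : K ≤ max K 1 := le_max_left _ _
  refine ⟨max K 1, by positivity, fun θ hθ x hx y => (hK θ hθ x hx y).1.trans hle,
    fun θ hθ x hx y => (hK θ hθ x hx y).2.1.trans hle, fun θ hθ θ' hθ' x hx y => ?_⟩
  exact hreg.convex.norm_image_sub_le_of_norm_fderiv_le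
    (fun z hz => hreg.twice_differentiable z hz x y)
    (fun z hz => (hK z hz x hx y).2.2.trans hle) hθ' hθ

/-- Only the loss itself is assumed measurable in `x`. Directional derivatives are pointwise limits
of its difference quotients, and the gradient is recovered from its coordinates. -/
theorem LossRegular.measurable_lossGrad (hreg : LossRegular Θ ℓ) {θ : Vec d} (hθ : θ ∈ Θ)
    (y : Fin 2) : Measurable fun x => lossGrad ℓ θ x y := by
  have hinner : ∀ v : Vec d, Measurable fun x => ⟪lossGrad ℓ θ x y, v⟫ := by
    intro v
    have hlim : Tendsto (fun n : ℕ => θ + (n : ℝ)⁻¹ • v) atTop (𝓝 θ) := by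
      simpa using ((tendsto_inv_atTop_nhds_zero_nat (𝕜 := ℝ)).smul_const v).const_add θ
    -- The shift by `n₀` keeps the evaluation points inside `Θ`, where measurability is known.
    obtain ⟨n₀, hn₀⟩ := eventually_atTop.1 (hlim (hreg.isOpen.mem_nhds hθ))
    refine measurable_of_tendsto_metrizable
      (f := fun (n : ℕ) x => (((n + n₀ : ℕ) : ℝ)) •
        (ℓ (θ + (((n + n₀ : ℕ) : ℝ))⁻¹ • v) x y - ℓ θ x y)) (fun n => ?_) ?_
    · exact ((hreg.measurable _ (hn₀ (n + n₀) (Nat.le_add_left _ _)) y).sub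
        (hreg.measurable θ hθ y)).const_mul _
    · refine tendsto_pi_nhds.2 fun x => ?_
      have h := (hreg.hasGradientAt hθ x y).hasFDerivAt.lim v
        (c := fun n : ℕ => ((n + n₀ : ℕ) : ℝ)) (l := atTop) ?_
      · simpa using h
      · refine tendsto_norm_atTop_atTop.comp (tendsto_natCast_atTop_atTop.comp ?_)
        exact tendsto_add_atTop_nat n₀
  have hrepr : (fun x => lossGrad ℓ θ x y) = fun x => ∑ i,
      ⟪lossGrad ℓ θ x y, EuclideanSpace.basisFun (Fin d) ℝ i⟫ •
        EuclideanSpace.basisFun (Fin d) ℝ i := by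
    funext x
    conv_lhs => rw [← (EuclideanSpace.basisFun (Fin d) ℝ).sum_repr' (lossGrad ℓ θ x y)]
    simp_rw [real_inner_comm]
  rw [hrepr]
  exact Finset.measurable_fun_sum _ fun i _ => (hinner _).smul_const _

variable {r K : ℝ} {P : Measure (Vec p)} [IsProbabilityMeasure P]

theorem LossBounds.integrable_lossGrad (hb : LossBounds Θ ℓ r K) (hreg : LossRegular Θ ℓ)
    (hP : ∀ᵐ x ∂P, ‖x‖ ≤ r) {θ : Vec d} (hθ : θ ∈ Θ) (y : Fin 2) :
    Integrable (fun x => lossGrad ℓ θ x y) P :=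
  Integrable.of_bound (hreg.measurable_lossGrad hθ y).aestronglyMeasurable K
    (hP.mono fun x hx => hb.grad θ hθ x hx y)

/-- Differentiation under the integral sign, dominated by the constant `K`; the Riesz isomorphism
commutes with the integral. -/
theorem LossBounds.hasGradientAt_classRisk (hb : LossBounds Θ ℓ r K) (hreg : LossRegular Θ ℓ)
    (hP : ∀ᵐ x ∂P, ‖x‖ ≤ r) {θ : Vec d} (hθ : θ ∈ Θ) (y : Fin 2) :
    HasGradientAt (classRisk ℓ P y) (meanGrad ℓ P y θ) θ := by
  have hΘ : Θ ∈ 𝓝 θ := hreg.isOpen.mem_nhds hθ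
  have hmeas : ∀ θ ∈ Θ, AEStronglyMeasurable (fun x => ℓ θ x y) P := fun θ hθ =>
    (hreg.measurable θ hθ y).aestronglyMeasurable
  have hint := hb.integrable_lossGrad hreg hP hθ y
  have hdual : Integrable (fun x => InnerProductSpace.toDual ℝ (Vec d) (lossGrad ℓ θ x y)) P :=
    Integrable.of_bound ((InnerProductSpace.toDual ℝ (Vec d)).continuous.comp_aestronglyMeasurable
      hint.aestronglyMeasurable) K (hP.mono fun x hx => by
        simpa using hb.grad θ hθ x hx y)
  have h := hasFDerivAt_integral_of_dominated_of_fderiv_le (μ := P) (𝕜 := ℝ)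
    (F := fun θ x => ℓ θ x y)
    (F' := fun θ x => InnerProductSpace.toDual ℝ (Vec d) (lossGrad ℓ θ x y))
    (bound := fun _ => K) hΘ (eventually_of_mem hΘ hmeas)
    (Integrable.of_bound (hmeas θ hθ) K (hP.mono fun x hx => hb.value θ hθ x hx y))
    hdual.aestronglyMeasurable
    (hP.mono fun x hx z hz => by simpa using hb.grad z hz x hx y)
    (integrable_const K)
    (Eventually.of_forall fun x z hz => (hreg.hasGradientAt hz x y).hasFDerivAt)
  have heq : ∫ x, InnerProductSpace.toDual ℝ (Vec d) (lossGrad ℓ θ x y) ∂P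
      = InnerProductSpace.toDual ℝ (Vec d) (meanGrad ℓ P y θ) := by
    ext v
    rw [ContinuousLinearMap.integral_apply hdual]
    simp only [InnerProductSpace.toDual_apply_apply]
    rw [meanGrad, real_inner_comm, ← integral_inner hint]
    simp_rw [real_inner_comm]
  rw [heq] at h
  exact h

theorem LossBounds.meanGrad_lipschitz (hb : LossBounds Θ ℓ r K) (hreg : LossRegular Θ ℓ)
    (hP : ∀ᵐ x ∂P, ‖x‖ ≤ r) {θ θ' : Vec d} (hθ : θ ∈ Θ) (hθ' : θ' ∈ Θ) (y : Fin 2) :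
    ‖meanGrad ℓ P y θ - meanGrad ℓ P y θ'‖ ≤ K * ‖θ - θ'‖ := by
  rw [meanGrad, meanGrad, ← integral_sub (hb.integrable_lossGrad hreg hP hθ y)
    (hb.integrable_lossGrad hreg hP hθ' y)]
  refine (norm_integral_le_of_norm_le_const (C := K * ‖θ - θ'‖) ?_).trans (by simp)
  exact hP.mono fun x hx => hb.grad_lipschitz θ hθ θ' hθ' x hx y

end

/-! ### Deterministic stability of minimizers -/

theorem IsArgmin.hasGradientAt_eq_zero {Θ : Set (Vec d)} (hΘ : IsOpen Θ) {f : Vec d → ℝ}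
    {θ g : Vec d} (h : IsArgmin f Θ θ) (hf : HasGradientAt f g θ) : g = 0 := by
  have hmin : IsLocalMin f θ := eventually_of_mem (hΘ.mem_nhds h.1) h.2
  have := hmin.hasFDerivAt_eq_zero hf.hasFDerivAt
  simpa using this

/-- A lower bound on the Hessian gives a quadratic lower bound on the function. -/
theorem quadratic_lower_bound_of_hessian {Θ : Set (Vec d)} (hΘ : Convex ℝ Θ)
    {f : Vec d → ℝ} (hf : ∀ θ ∈ Θ, DifferentiableAt ℝ f θ) {lam : ℝ} (hlam : 0 < lam)
    (hH : ∀ θ ∈ Θ, ∀ v : Vec d, lam * ‖v‖ ^ 2 ≤ ⟪v, hessian f θ v⟫) {a b : Vec d} (ha : a ∈ Θ)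
    (hb : b ∈ Θ) : f a + ⟪∇ f a, b - a⟫ + lam / 2 * ‖b - a‖ ^ 2 ≤ f b := by
  rcases eq_or_ne b a with rfl | hne
  · simp
  set v : Vec d := b - a with hv
  have hv0 : 0 < ‖v‖ := norm_pos_iff.2 (sub_ne_zero.2 hne)
  -- Differentiability of the gradient is automatic: where it failed, the Hessian would take the
  -- default value `0`, against the lower bound at `v ≠ 0`.
  have hG : ∀ θ ∈ Θ, HasFDerivAt (∇ f) (hessian f θ) θ := by
    intro θ hθ
    refine DifferentiableAt.hasFDerivAt ?_
    by_contra hnd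
    have h1 := hH θ hθ v
    rw [hessian, fderiv_zero_of_not_differentiableAt hnd] at h1
    have : 0 < lam * ‖v‖ ^ 2 := by positivity
    simp at h1
    linarith
  have hmem : ∀ t ∈ Set.Icc (0 : ℝ) 1, a + t • v ∈ Θ := by
    intro t ht
    have := hΘ.add_smul_sub_mem ha hb ht
    simpa [hv] using this
  have hline : ∀ t : ℝ, HasDerivAt (fun t : ℝ => a + t • v) v t := fun t => by
    simpa using ((hasDerivAt_id t).smul_const v).const_add a
  set q : ℝ → ℝ := fun t => ⟪∇ f (a + t • v), v⟫ with hq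
  have h1 : ∀ t ∈ Set.Icc (0 : ℝ) 1, HasDerivAt (fun t => f (a + t • v)) (q t) t := by
    intro t ht
    have := (hf _ (hmem t ht)).hasGradientAt.hasFDerivAt.comp_hasDerivAt t (hline t)
    rwa [InnerProductSpace.toDual_apply_apply] at this
  have h2 : ∀ t ∈ Set.Icc (0 : ℝ) 1, HasDerivAt q ⟪hessian f (a + t • v) v, v⟫ t := by
    intro t ht
    have := ((hG _ (hmem t ht)).comp_hasDerivAt t (hline t)).inner ℝ (hasDerivAt_const t v)
    rwa [inner_zero_right, zero_add] at this
  -- Two monotonicity arguments along the segment replace Taylor's formula, so no continuity of the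
  -- Hessian is needed.
  have h3 : ∀ t ∈ Set.Icc (0 : ℝ) 1,
      HasDerivAt (fun t => q t - lam * ‖v‖ ^ 2 * t)
        (⟪hessian f (a + t • v) v, v⟫ - lam * ‖v‖ ^ 2) t := fun t ht => by
    have := (h2 t ht).sub ((hasDerivAt_id t).const_mul (lam * ‖v‖ ^ 2))
    rwa [mul_one] at this
  have hqmono : MonotoneOn (fun t => q t - lam * ‖v‖ ^ 2 * t) (Set.Icc (0 : ℝ) 1) := by
    refine monotoneOn_of_deriv_nonneg (convex_Icc _ _)
      (fun t ht => (h3 t ht).continuousAt.continuousWithinAt)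
      (fun t ht => (h3 t (interior_subset ht)).differentiableAt.differentiableWithinAt) ?_
    intro t ht
    rw [(h3 t (interior_subset ht)).deriv, real_inner_comm]
    exact sub_nonneg.2 (hH _ (hmem t (interior_subset ht)) v)
  have h4 : ∀ t ∈ Set.Icc (0 : ℝ) 1,
      HasDerivAt (fun t => f (a + t • v) - q 0 * t - lam / 2 * ‖v‖ ^ 2 * t ^ 2)
        (q t - q 0 - lam * ‖v‖ ^ 2 * t) t := fun t ht => by
    have := ((h1 t ht).sub ((hasDerivAt_id t).const_mul (q 0))).sub
      ((hasDerivAt_pow 2 t).const_mul (lam / 2 * ‖v‖ ^ 2))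
    have heq : q t - q 0 - lam * ‖v‖ ^ 2 * t
        = q t - q 0 * 1 - lam / 2 * ‖v‖ ^ 2 * ((2 : ℕ) * t ^ (2 - 1)) := by
      push_cast
      ring
    rw [heq]
    exact this
  have hpmono : MonotoneOn (fun t => f (a + t • v) - q 0 * t - lam / 2 * ‖v‖ ^ 2 * t ^ 2)
      (Set.Icc (0 : ℝ) 1) := by
    refine monotoneOn_of_deriv_nonneg (convex_Icc _ _)
      (fun t ht => (h4 t ht).continuousAt.continuousWithinAt)
      (fun t ht => (h4 t (interior_subset ht)).differentiableAt.differentiableWithinAt) ?_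
    intro t ht
    have ht' := interior_subset ht
    rw [(h4 t ht').deriv]
    have := hqmono (Set.left_mem_Icc.2 zero_le_one) ht' ht'.1
    simp only [mul_zero, sub_zero] at this
    linarith
  have := hpmono (Set.left_mem_Icc.2 zero_le_one) (Set.right_mem_Icc.2 zero_le_one) zero_le_one
  simp only [hq, zero_smul, add_zero, one_smul, mul_zero, sub_zero, mul_one, one_pow] at this
  have hav : a + v = b := by rw [hv]; abel
  rw [hav] at this
  simp only [ne_eq, OfNat.ofNat_ne_zero, not_false_eq_true, zero_pow, mul_zero, sub_zero] at this
  linarith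

/-- A function whose gradient is uniformly `δ`-close to that of a strongly convex function with an
almost critical point `θ₀` has minimizers, all of which are close to `θ₀`. -/
theorem exists_isArgmin_of_gradient_close {Θ : Set (Vec d)} (hΘ : Convex ℝ Θ)
    {f h : Vec d → ℝ} {gf gh : Vec d → Vec d} (hf : ∀ θ ∈ Θ, HasGradientAt f (gf θ) θ)
    (hh : ∀ θ ∈ Θ, HasGradientAt h (gh θ) θ) {lam δ δ' ρ : ℝ} {θ₀ : Vec d} (hlam : 0 < lam)
    (hθ₀ : θ₀ ∈ Θ)
    (hquad : ∀ θ ∈ Θ, f θ₀ + ⟪gf θ₀, θ - θ₀⟫ + lam / 2 * ‖θ - θ₀‖ ^ 2 ≤ f θ)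
    (hclose : ∀ θ ∈ Θ, ‖gh θ - gf θ‖ ≤ δ) (hcrit : ‖gf θ₀‖ ≤ δ')
    (hρ : 2 * (δ + δ') / lam ≤ ρ) (hball : Metric.closedBall θ₀ ρ ⊆ Θ) :
    (∃ θ, IsArgmin h Θ θ) ∧ ∀ θ, IsArgmin h Θ θ → ‖θ - θ₀‖ ≤ ρ := by
  have hδ : 0 ≤ δ := (norm_nonneg _).trans (hclose θ₀ hθ₀)
  have hδ' : 0 ≤ δ' := (norm_nonneg _).trans hcrit
  have hρ0 : 0 ≤ ρ := le_trans (by positivity) hρ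
  have hdiff : ∀ θ ∈ Θ, |(h θ - f θ) - (h θ₀ - f θ₀)| ≤ δ * ‖θ - θ₀‖ := by
    intro θ hθ
    have hder : ∀ z ∈ Θ, HasFDerivAt (fun θ => h θ - f θ)
        (InnerProductSpace.toDual ℝ (Vec d) (gh z - gf z)) z := fun z hz => by
      have := (hh z hz).hasFDerivAt.sub (hf z hz).hasFDerivAt
      rw [← map_sub] at this
      exact this
    exact hΘ.norm_image_sub_le_of_norm_hasFDerivWithin_le
      (fun z hz => (hder z hz).hasFDerivWithinAt)
      (fun z hz => by rw [LinearIsometryEquiv.norm_map]; exact hclose z hz) hθ₀ hθ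
  -- At distance `t > ρ` the quadratic gain `lam / 2 * t²` exceeds the linear loss `(δ + δ') t`. A
  -- minimizer over the compact ball is thus one over the open set `Θ`.
  have hgrow : ∀ θ ∈ Θ, ρ < ‖θ - θ₀‖ → h θ₀ < h θ := by
    intro θ hθ hlt
    have h1 := (abs_le.1 (hdiff θ hθ)).1
    have h2 := hquad θ hθ
    have h3 : -(δ' * ‖θ - θ₀‖) ≤ ⟪gf θ₀, θ - θ₀⟫ := by
      have := (abs_le.1 (abs_real_inner_le_norm (gf θ₀) (θ - θ₀))).1
      have := mul_le_mul_of_nonneg_right hcrit (norm_nonneg (θ - θ₀))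
      linarith
    have h4 : 2 * (δ + δ') < lam * ‖θ - θ₀‖ := by
      rw [mul_comm lam]
      exact (div_lt_iff₀ hlam).1 (hρ.trans_lt hlt)
    have h5 : 0 < ‖θ - θ₀‖ := hρ0.trans_lt hlt
    nlinarith [mul_pos h5 (sub_pos.2 h4)]
  refine ⟨?_, fun θ hθ => ?_⟩
  · have hcont : ContinuousOn h (Metric.closedBall θ₀ ρ) := fun z hz =>
      (hh z (hball hz)).differentiableAt.continuousAt.continuousWithinAt
    obtain ⟨z, hz, hzmin⟩ := (isCompact_closedBall θ₀ ρ).exists_isMinOn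
      ⟨θ₀, Metric.mem_closedBall_self hρ0⟩ hcont
    refine ⟨z, hball hz, fun θ hθ => ?_⟩
    by_cases hd : ‖θ - θ₀‖ ≤ ρ
    · exact hzmin (by simpa [dist_eq_norm] using hd)
    · exact (hzmin (Metric.mem_closedBall_self hρ0)).trans (hgrow θ hθ (not_le.1 hd)).le
  · by_contra hlt
    exact absurd (hθ.2 θ₀ hθ₀) (not_le.2 (hgrow θ hθ.1 (not_le.1 hlt)))

/-- The excess of a function with Lipschitz gradient over a critical point is at most quadratic. -/
theorem sub_le_of_gradient_lipschitz {Θ : Set (Vec d)} (hΘ : Convex ℝ Θ) {f : Vec d → ℝ}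
    {g : Vec d → Vec d} (hf : ∀ θ ∈ Θ, HasGradientAt f (g θ) θ) {K : ℝ} {θ₀ θ : Vec d}
    (hK : 0 ≤ K)
    (hθ₀ : θ₀ ∈ Θ) (hθ : θ ∈ Θ) (hg : ∀ θ ∈ Θ, ‖g θ‖ ≤ K * ‖θ - θ₀‖) :
    |f θ - f θ₀| ≤ K * ‖θ - θ₀‖ ^ 2 := by
  -- Intersecting with the ball keeps convexity and bounds the gradient by `K * ‖θ - θ₀‖`.
  have h := (hΘ.inter (convex_closedBall θ₀ ‖θ - θ₀‖)).norm_image_sub_le_of_norm_hasFDerivWithin_le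
    (f := f) (f' := fun z => InnerProductSpace.toDual ℝ (Vec d) (g z)) (C := K * ‖θ - θ₀‖)
    (fun z hz => (hf z hz.1).hasFDerivAt.hasFDerivWithinAt)
    (fun z hz => by
      simp only [LinearIsometryEquiv.norm_map]
      refine (hg z hz.1).trans (mul_le_mul_of_nonneg_left ?_ hK)
      simpa [dist_eq_norm] using hz.2)
    ⟨hθ₀, Metric.mem_closedBall_self (norm_nonneg _)⟩ ⟨hθ, by simp [dist_eq_norm]⟩
  rw [pow_two, ← mul_assoc]
  exact h

/-! ### Gradients of the risks -/

theorem HasGradientAt.const_mul_add {f g : Vec d → ℝ} {u v θ : Vec d} (a b : ℝ)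
    (hf : HasGradientAt f u θ) (hg : HasGradientAt g v θ) :
    HasGradientAt (fun θ => a * f θ + b * g θ) (a • u + b • v) θ := by
  have h := (hf.hasFDerivAt.const_mul a).add (hg.hasFDerivAt.const_mul b)
  have hmap : InnerProductSpace.toDual ℝ (Vec d) (a • u + b • v)
      = a • InnerProductSpace.toDual ℝ (Vec d) u + b • InnerProductSpace.toDual ℝ (Vec d) v := by
    simp
  rw [← hmap] at h
  exact h

theorem LossRegular.hasGradientAt_empiricalRisk {Θ : Set (Vec d)}
    {ℓ : Vec d → Vec p → Fin 2 → ℝ} (hreg : LossRegular Θ ℓ) {n₀ n₁ m : ℕ}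
    (x : SampleIdx n₀ n₁ m → Vec p) {θ : Vec d} (hθ : θ ∈ Θ) :
    HasGradientAt (empiricalRisk ℓ x)
      ((1 / ((n₀ : ℝ) + n₁ + m)) • ∑ i, lossGrad ℓ θ (x i) (sampleLabel i)) θ := by
  have h := (HasFDerivAt.fun_sum fun (i : SampleIdx n₀ n₁ m) (_ : i ∈ Finset.univ) =>
    (hreg.hasGradientAt hθ (x i) (sampleLabel i)).hasFDerivAt).const_mul
      (1 / ((n₀ : ℝ) + n₁ + m))
  rw [hasGradientAt_iff_hasFDerivAt]
  rw [map_smul, map_sum]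
  exact h

/-- Identifies the mean of the empirical gradient with the gradient of `R̃`, the centre of the
deviation bound. -/
theorem sum_meanGrad_sampleLaw (ℓ : Vec d → Vec p → Fin 2 → ℝ) (P₀ P₁ Psyn : Measure (Vec p))
    (n₀ n₁ m : ℕ) (θ : Vec d) :
    (1 / ((n₀ : ℝ) + n₁ + m)) • ∑ i : SampleIdx n₀ n₁ m,
        meanGrad ℓ (sampleLaw P₀ P₁ Psyn i) (sampleLabel i) θ
      = share n₀ n₀ n₁ m • meanGrad ℓ P₀ 0 θ + share n₁ n₀ n₁ m • meanGrad ℓ P₁ 1 θ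
        + share m n₀ n₁ m • meanGrad ℓ Psyn 1 θ := by
  simp only [Fintype.sum_sum_type, sampleLaw, sampleLabel, Sum.elim_inl, Sum.elim_inr,
    Finset.sum_const, Finset.card_univ, Fintype.card_fin, share,
    ← Nat.cast_smul_eq_nsmul ℝ]
  module

section
variable {Θ : Set (Vec d)} {ℓ : Vec d → Vec p → Fin 2 → ℝ} {r K : ℝ}
  {P₀ P₁ Psyn : Measure (Vec p)} [IsProbabilityMeasure P₀] [IsProbabilityMeasure P₁]
  [IsProbabilityMeasure Psyn]

theorem LossBounds.hasGradientAt_balancedRisk (hb : LossBounds Θ ℓ r K)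
    (hreg : LossRegular Θ ℓ) (h₀ : ∀ᵐ x ∂P₀, ‖x‖ ≤ r) (h₁ : ∀ᵐ x ∂P₁, ‖x‖ ≤ r) {θ : Vec d}
    (hθ : θ ∈ Θ) :
    HasGradientAt (balancedRisk ℓ P₀ P₁)
      ((1 / 2 : ℝ) • meanGrad ℓ P₀ 0 θ + (1 / 2 : ℝ) • meanGrad ℓ P₁ 1 θ) θ :=
  (hb.hasGradientAt_classRisk hreg h₀ hθ 0).const_mul_add _ _
    (hb.hasGradientAt_classRisk hreg h₁ hθ 1)

theorem LossBounds.gradient_psi (hb : LossBounds Θ ℓ r K) (hreg : LossRegular Θ ℓ)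
    (h₁ : ∀ᵐ x ∂P₁, ‖x‖ ≤ r) (hs : ∀ᵐ x ∂Psyn, ‖x‖ ≤ r) {θ : Vec d} (hθ : θ ∈ Θ) :
    ∇ (psi ℓ P₁ Psyn) θ = meanGrad ℓ Psyn 1 θ - meanGrad ℓ P₁ 1 θ := by
  have h := (hb.hasGradientAt_classRisk hreg hs hθ 1).const_mul_add 1 (-1)
    (hb.hasGradientAt_classRisk hreg h₁ hθ 1)
  have hpsi : psi ℓ P₁ Psyn = fun θ => 1 * classRisk ℓ Psyn 1 θ + (-1) * classRisk ℓ P₁ 1 θ := by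
    funext θ
    simp only [psi]
    ring
  rw [hpsi, h.gradient]
  module

theorem LossBounds.hasGradientAt_syntheticRisk (hb : LossBounds Θ ℓ r K)
    (hreg : LossRegular Θ ℓ) (h₀ : ∀ᵐ x ∂P₀, ‖x‖ ≤ r) (h₁ : ∀ᵐ x ∂P₁, ‖x‖ ≤ r)
    (hs : ∀ᵐ x ∂Psyn, ‖x‖ ≤ r) (n₀ n₁ m : ℕ) {θ : Vec d} (hθ : θ ∈ Θ) :
    HasGradientAt (syntheticRisk ℓ P₀ P₁ Psyn n₀ n₁ m)
      (share n₀ n₀ n₁ m • meanGrad ℓ P₀ 0 θ + share n₁ n₀ n₁ m • meanGrad ℓ P₁ 1 θ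
        + share m n₀ n₁ m • meanGrad ℓ Psyn 1 θ) θ := by
  have h := ((hb.hasGradientAt_classRisk hreg h₀ hθ 0).const_mul_add (share n₀ n₀ n₁ m)
    (share n₁ n₀ n₁ m) (hb.hasGradientAt_classRisk hreg h₁ hθ 1)).const_mul_add 1
    (share m n₀ n₁ m) (hb.hasGradientAt_classRisk hreg hs hθ 1)
  simp only [one_mul, one_smul] at h
  exact h

/-- At a critical point of the balanced risk, the gradient of the synthetic risk is controlled by
the imbalance of the augmented sample and by the gradient of the discrepancy `ψ`. -/
theorem norm_syntheticGrad_le {n₀ n₁ m : ℕ} (hn₀ : 0 < n₀) {g₀ g₁ gs : Vec d}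
    (hcrit : (1 / 2 : ℝ) • g₀ + (1 / 2 : ℝ) • g₁ = 0) :
    ‖share n₀ n₀ n₁ m • g₀ + share n₁ n₀ n₁ m • g₁ + share m n₀ n₁ m • gs‖
      ≤ |(m : ℝ) - ((n₀ : ℝ) - n₁)| / n₀ * ‖g₀‖ + ‖gs - g₁‖ := by
  have hn : (0 : ℝ) < n₀ := by exact_mod_cast hn₀
  have hN : (0 : ℝ) < (n₀ : ℝ) + n₁ + m := by positivity
  have hg : g₁ = -g₀ := by
    rw [← smul_add, smul_eq_zero_iff_right (by norm_num)] at hcrit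
    exact (neg_eq_of_add_eq_zero_right hcrit).symm
  have hdecomp : share n₀ n₀ n₁ m • g₀ + share n₁ n₀ n₁ m • g₁ + share m n₀ n₁ m • gs
      = ((n₀ - n₁ - m : ℝ) / ((n₀ : ℝ) + n₁ + m)) • g₀ + share m n₀ n₁ m • (gs - g₁) := by
    rw [hg]
    simp only [share, sub_div]
    module
  rw [hdecomp]
  refine (norm_add_le _ _).trans (add_le_add ?_ ?_)
  · rw [norm_smul, Real.norm_eq_abs, abs_div, abs_of_pos hN, abs_sub_comm]
    gcongr
    have := Nat.cast_nonneg (α := ℝ) n₁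
    have := Nat.cast_nonneg (α := ℝ) m
    linarith
  · rw [norm_smul]
    refine mul_le_of_le_one_left (norm_nonneg _) ?_
    rw [share, Real.norm_of_nonneg (by positivity), div_le_one hN]
    have := Nat.cast_nonneg (α := ℝ) n₁
    linarith

end

/-! ### Uniform deviation of the empirical gradient -/

/-- The empirical gradient deviates from its mean by `O_P(n^{-1/2})`, uniformly over the parameter
set and over all sample distributions on a fixed ball. -/
theorem LossBounds.exists_sup_deviation.{u} {Θ : Set (Vec d)} {ℓ : Vec d → Vec p → Fin 2 → ℝ}
    {r K : ℝ} (hb : LossBounds Θ ℓ r K) (hreg : LossRegular Θ ℓ) {θ₀ : Vec d} (hθ₀ : θ₀ ∈ Θ)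
    (hd : 0 < d) {ε : ℝ} (hε : 0 < ε) :
    ∃ A : ℝ, 0 < A ∧ ∀ (Ω : Type u) [MeasurableSpace Ω] (μ : Measure Ω) [IsProbabilityMeasure μ]
      (ι : Type) [Fintype ι] (y : ι → Fin 2) (X : ι → Ω → Vec p), 0 < Fintype.card ι →
      iIndepFun X μ → (∀ i, Measurable (X i)) → (∀ i, ∀ᵐ ω ∂μ, ‖X i ω‖ ≤ r) →
      μ {ω | ∃ θ ∈ Θ, A < ‖(√(Fintype.card ι : ℝ))⁻¹ •
          ∑ i, (lossGrad ℓ θ (X i ω) (y i) - ∫ ω, lossGrad ℓ θ (X i ω) (y i) ∂μ)‖}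
        ≤ ENNReal.ofReal ε := by
  have hK := hb.pos
  have hdR : (0 : ℝ) < d := by exact_mod_cast hd
  -- For each of the `d` coordinates, half of `ε / d` pays for the increments from `θ₀` and half for
  -- the value at `θ₀`.
  obtain ⟨A₁, hA₁, hchain⟩ := exists_sup_bound_of_subgaussian_increments.{u} hreg.bounded hθ₀ hK
    (show 0 < ε / (2 * d) by positivity)
  have hexp : Tendsto (fun s : ℝ => 2 * Real.exp (-s ^ 2 / 2)) atTop (𝓝 (2 * 0)) := by
    refine (Real.tendsto_exp_atBot.comp ?_).const_mul 2
    simp_rw [neg_div]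
    exact tendsto_neg_atTop_atBot.comp
      ((tendsto_pow_atTop two_ne_zero).atTop_div_const (by positivity))
  obtain ⟨s, hs, hs0⟩ := ((hexp.eventually_le_const (show 2 * 0 < ε / (2 * d) by
    rw [mul_zero]; positivity)).and (eventually_ge_atTop (0 : ℝ))).exists
  refine ⟨d * (A₁ + s * K), by positivity, fun Ω _ μ _ ι _ y X hn hind hX hXr => ?_⟩
  set n : ℝ := (Fintype.card ι : ℝ) with hndef
  set e : Fin d → Vec d := fun j => EuclideanSpace.basisFun (Fin d) ℝ j with he
  have he1 : ∀ j, ‖e j‖ = 1 := fun j => (EuclideanSpace.basisFun (Fin d) ℝ).norm_eq_one j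
  set Y : Fin d → Vec d → ι → Ω → ℝ := fun j θ i ω => ⟪e j, lossGrad ℓ θ (X i ω) (y i)⟫ with hY
  set W : Fin d → Vec d → Ω → ℝ := fun j θ ω =>
    (√n)⁻¹ * ∑ i, (Y j θ i ω - ∫ ω, Y j θ i ω ∂μ) with hW
  have hgm : ∀ θ ∈ Θ, ∀ i, Measurable fun ω => lossGrad ℓ θ (X i ω) (y i) := fun θ hθ i =>
    (hreg.measurable_lossGrad hθ (y i)).comp (hX i)
  have hgi : ∀ θ ∈ Θ, ∀ i, Integrable (fun ω => lossGrad ℓ θ (X i ω) (y i)) μ := fun θ hθ i =>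
    Integrable.of_bound (hgm θ hθ i).aestronglyMeasurable K
      ((hXr i).mono fun ω hω => hb.grad θ hθ _ hω _)
  have hYm : ∀ j, ∀ θ ∈ Θ, ∀ i, Measurable (Y j θ i) := fun j θ hθ i =>
    (hgm θ hθ i).const_inner
  have hYi : ∀ j, ∀ θ ∈ Θ, ∀ i, Integrable (Y j θ i) μ := fun j θ hθ i =>
    (hgi θ hθ i).const_inner _
  have hYlip : ∀ j, ∀ a ∈ Θ, ∀ b ∈ Θ, ∀ i ω, ‖X i ω‖ ≤ r →
      |Y j a i ω - Y j b i ω| ≤ K * ‖a - b‖ := by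
    intro j a ha b hb' i ω hω
    rw [hY, ← inner_sub_right]
    refine (abs_real_inner_le_norm _ _).trans ?_
    rw [he1, one_mul]
    exact hb.grad_lipschitz a ha b hb' _ hω _
  have hYmean : ∀ j, ∀ a ∈ Θ, ∀ b ∈ Θ, ∀ i,
      |∫ ω, Y j a i ω ∂μ - ∫ ω, Y j b i ω ∂μ| ≤ K * ‖a - b‖ := by
    intro j a ha b hb' i
    rw [← integral_sub (hYi j a ha i) (hYi j b hb' i)]
    have := norm_integral_le_of_norm_le_const (μ := μ) (C := K * ‖a - b‖)
      (f := fun ω => Y j a i ω - Y j b i ω) ((hXr i).mono fun ω hω => hYlip j a ha b hb' i ω hω)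
    simpa using this
  have hcontOn : ∀ f : Vec d → ℝ, (∀ a ∈ Θ, ∀ b ∈ Θ, |f a - f b| ≤ K * ‖a - b‖) →
      ContinuousOn f Θ := fun f hf => by
    refine (LipschitzOnWith.of_dist_le_mul (K := K.toNNReal) fun a ha b hb' => ?_).continuousOn
    rw [Real.coe_toNNReal _ hK.le, Real.dist_eq, dist_eq_norm]
    exact hf a ha b hb'
  have hXall : ∀ᵐ ω ∂μ, ∀ i, ‖X i ω‖ ≤ r := ae_all_iff.2 hXr
  have hcont : ∀ j, ∀ᵐ ω ∂μ, ContinuousOn (fun θ => W j θ ω) Θ := by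
    intro j
    filter_upwards [hXall] with ω hω
    refine continuousOn_const.mul (continuousOn_finsetSum _ fun i _ => ContinuousOn.sub ?_ ?_)
    · exact hcontOn _ fun a ha b hb' => hYlip j a ha b hb' i ω (hω i)
    · exact hcontOn _ fun a ha b hb' => hYmean j a ha b hb' i
  -- The summands of an increment are bounded by `K * ‖a - b‖`, so Hoeffding at level `s / K` gives
  -- the sub-Gaussian tail.
  have htail : ∀ j, ∀ a ∈ Θ, ∀ b ∈ Θ, ∀ s : ℝ, 0 ≤ s →
      μ {ω | s * ‖a - b‖ < |W j a ω - W j b ω|}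
        ≤ ENNReal.ofReal (2 * Real.exp (-s ^ 2 / (2 * K ^ 2))) := by
    intro j a ha b hb' s hs
    rcases eq_or_ne a b with rfl | hab
    · simp
    have hpos : 0 < ‖a - b‖ := norm_pos_iff.2 (sub_ne_zero.2 hab)
    have hindY : iIndepFun (fun i ω => Y j a i ω - Y j b i ω) μ :=
      hind.comp (fun i x => ⟪e j, lossGrad ℓ a x (y i)⟫ - ⟪e j, lossGrad ℓ b x (y i)⟫) fun i =>
        (hreg.measurable_lossGrad ha (y i)).const_inner.sub
          (hreg.measurable_lossGrad hb' (y i)).const_inner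
    have h := measure_abs_normalized_sum_gt_le hindY
      (fun i => ((hYm j a ha i).sub (hYm j b hb' i)).aemeasurable) (mul_pos hK hpos)
      (fun i => (hXr i).mono fun ω hω => hYlip j a ha b hb' i ω hω) hn
      (div_nonneg hs hK.le)
    have hset : {ω | s * ‖a - b‖ < |W j a ω - W j b ω|}
        = {ω | s / K * (K * ‖a - b‖) < |(√n)⁻¹ * ∑ i, ((Y j a i ω - Y j b i ω)
            - ∫ ω, (Y j a i ω - Y j b i ω) ∂μ)|} := by
      ext ω
      have h1 : s / K * (K * ‖a - b‖) = s * ‖a - b‖ := by field_simp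
      have h2 : W j a ω - W j b ω = (√n)⁻¹ * ∑ i, ((Y j a i ω - Y j b i ω)
            - ∫ ω, (Y j a i ω - Y j b i ω) ∂μ) := by
        rw [hW, ← mul_sub, ← Finset.sum_sub_distrib]
        congr 1
        refine Finset.sum_congr rfl fun i _ => ?_
        rw [integral_sub (hYi j a ha i) (hYi j b hb' i)]
        ring
      rw [Set.mem_ofPred_eq, Set.mem_ofPred_eq, h1, h2]
    have hexp' : -(s / K) ^ 2 / 2 = -s ^ 2 / (2 * K ^ 2) := by
      rw [div_pow]; field_simp
    rw [hset, ← hexp']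
    exact h
  have hbase : ∀ j, μ {ω | s * K < |W j θ₀ ω|} ≤ ENNReal.ofReal (ε / (2 * d)) := by
    intro j
    refine (measure_abs_normalized_sum_gt_le (Y := Y j θ₀) ?_
      (fun i => (hYm j θ₀ hθ₀ i).aemeasurable) hK (fun i => (hXr i).mono fun ω hω => ?_) hn
      hs0).trans (ENNReal.ofReal_le_ofReal hs)
    · exact hind.comp (fun i x => ⟪e j, lossGrad ℓ θ₀ x (y i)⟫) fun i =>
        (hreg.measurable_lossGrad hθ₀ (y i)).const_inner
    · refine (abs_real_inner_le_norm _ _).trans ?_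
      rw [he1, one_mul]
      exact hb.grad θ₀ hθ₀ _ hω _
  have hnorm : ∀ θ ∈ Θ, ∀ ω, ‖(√n)⁻¹ •
      ∑ i, (lossGrad ℓ θ (X i ω) (y i) - ∫ ω, lossGrad ℓ θ (X i ω) (y i) ∂μ)‖
        ≤ ∑ j, |W j θ ω| := by
    intro θ hθ ω
    set G : Vec d := (√n)⁻¹ •
      ∑ i, (lossGrad ℓ θ (X i ω) (y i) - ∫ ω, lossGrad ℓ θ (X i ω) (y i) ∂μ) with hG
    have hcoord : ∀ j, ⟪e j, G⟫ = W j θ ω := by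
      intro j
      rw [hG, inner_smul_right, inner_sum]
      congr 1
      refine Finset.sum_congr rfl fun i _ => ?_
      rw [inner_sub_right, ← integral_inner (hgi θ hθ i)]
    rw [← (EuclideanSpace.basisFun (Fin d) ℝ).sum_repr' G]
    refine (norm_sum_le _ _).trans (Finset.sum_le_sum fun j _ => ?_)
    rw [norm_smul, ← hcoord j, OrthonormalBasis.norm_eq_one, mul_one]
    exact le_rfl
  have hsub : {ω | ∃ θ ∈ Θ, d * (A₁ + s * K) < ‖(√n)⁻¹ •
      ∑ i, (lossGrad ℓ θ (X i ω) (y i) - ∫ ω, lossGrad ℓ θ (X i ω) (y i) ∂μ)‖} ⊆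
      ⋃ j ∈ (Finset.univ : Finset (Fin d)),
        ({ω | ∃ θ ∈ Θ, A₁ < |W j θ ω - W j θ₀ ω|} ∪ {ω | s * K < |W j θ₀ ω|}) := by
    rintro ω ⟨θ, hθ, hlt⟩
    by_contra hnot
    simp only [Set.mem_iUnion, Finset.mem_univ, exists_true_left, not_exists, Set.mem_union,
      not_or, Set.mem_ofPred_eq, not_and, not_lt] at hnot
    refine absurd (hlt.trans_le (hnorm θ hθ ω)) (not_lt.2 ?_)
    calc ∑ j, |W j θ ω| ≤ ∑ _j : Fin d, (A₁ + s * K) := by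
          refine Finset.sum_le_sum fun j _ => ?_
          have h1 := (hnot j).1 θ hθ
          have h2 := (hnot j).2
          have h3 := abs_add_le (W j θ ω - W j θ₀ ω) (W j θ₀ ω)
          rw [sub_add_cancel] at h3
          linarith
      _ = d * (A₁ + s * K) := by simp [mul_add]
  refine (measure_mono hsub).trans ((measure_biUnion_finset_le _ _).trans ?_)
  calc ∑ j : Fin d, μ ({ω | ∃ θ ∈ Θ, A₁ < |W j θ ω - W j θ₀ ω|} ∪ {ω | s * K < |W j θ₀ ω|})
      ≤ ∑ _j : Fin d, ENNReal.ofReal (ε / d) := by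
        refine Finset.sum_le_sum fun j _ => (measure_union_le _ _).trans ?_
        refine (add_le_add (hchain Ω μ (W j) (hcont j) (htail j)) (hbase j)).trans_eq ?_
        rw [← ENNReal.ofReal_add (by positivity) (by positivity)]
        congr 1
        field_simp
        norm_num
    _ = ENNReal.ofReal ε := by
        rw [Finset.sum_const, Finset.card_univ, Fintype.card_fin, nsmul_eq_mul,
          ← ENNReal.ofReal_natCast, ← ENNReal.ofReal_mul hdR.le]
        congr 1
        field_simp

/-! ### Nondegeneracy of the gradient covariance -/

/-- A uniform lower bound on the gradient covariance along a sequence of parameters passes to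
nondegeneracy at the limit. -/
theorem LossBounds.variance_inner_lossGrad_ne_zero {Θ : Set (Vec d)}
    {ℓ : Vec d → Vec p → Fin 2 → ℝ} {r K : ℝ} (hb : LossBounds Θ ℓ r K)
    (hreg : LossRegular Θ ℓ) {P : Measure (Vec p)} [IsProbabilityMeasure P]
    (hP : ∀ᵐ x ∂P, ‖x‖ ≤ r) {y : Fin 2} {θ : Vec d} (hθ : θ ∈ Θ) {θseq : ℕ → Vec d}
    (hseq : ∀ k, θseq k ∈ Θ) (hlim : Tendsto θseq atTop (𝓝 θ)) {v : Vec d} {c : ℝ} (hc : 0 < c)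
    (hcov : ∀ k, c ≤ gradCov ℓ P y (θseq k) v v) :
    Var[fun x => ⟪v, lossGrad ℓ θ x y⟫; P] ≠ 0 := by
  intro hzero
  have hm : ∀ θ ∈ Θ, Measurable fun x => lossGrad ℓ θ x y := fun θ hθ =>
    hreg.measurable_lossGrad hθ y
  have hmem : MemLp (fun x => ⟪v, lossGrad ℓ θ x y⟫) 2 P :=
    MemLp.of_bound (hm θ hθ).const_inner.aestronglyMeasurable (‖v‖ * K)
      (hP.mono fun x hx => (norm_inner_le_norm _ _).trans
        (mul_le_mul_of_nonneg_left (hb.grad θ hθ x hx y) (norm_nonneg _)))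
  have hconst := ae_eq_integral_of_variance_eq_zero hmem hzero
  set a : ℝ := ∫ x, ⟪v, lossGrad ℓ θ x y⟫ ∂P with ha
  -- With zero variance at `θ` the score is a.s. a constant `a`; at `θseq k` it then stays within
  -- `δ` of `a`, and its variance is at most `δ²`.
  have hle : ∀ k, c ≤ (‖v‖ * (K * ‖θseq k - θ‖)) ^ 2 := by
    intro k
    set δ : ℝ := ‖v‖ * (K * ‖θseq k - θ‖) with hδ
    have hid : MemLp id 2 (P.map fun x => lossGrad ℓ (θseq k) x y) := by
      rw [memLp_map_measure_iff (by fun_prop) (hm _ (hseq k)).aemeasurable]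
      exact MemLp.of_bound (hm _ (hseq k)).aestronglyMeasurable K
        (hP.mono fun x hx => hb.grad _ (hseq k) x hx y)
    have := Measure.isProbabilityMeasure_map (μ := P) (hm _ (hseq k)).aemeasurable
    have hvar : gradCov ℓ P y (θseq k) v v = Var[fun x => ⟪v, lossGrad ℓ (θseq k) x y⟫; P] := by
      refine (covarianceBilin_self hid v).trans ?_
      rw [variance_map (by fun_prop) (hm _ (hseq k)).aemeasurable]
      rfl
    refine (hcov k).trans (hvar.trans_le ?_)
    have hbd : ∀ᵐ x ∂P, ⟪v, lossGrad ℓ (θseq k) x y⟫ ∈ Set.Icc (a - δ) (a + δ) := by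
      filter_upwards [hconst, hP] with x hx hxr
      have h1 : |⟪v, lossGrad ℓ (θseq k) x y⟫ - ⟪v, lossGrad ℓ θ x y⟫| ≤ δ := by
        rw [← inner_sub_right]
        exact (abs_real_inner_le_norm _ _).trans (mul_le_mul_of_nonneg_left
          (hb.grad_lipschitz _ (hseq k) _ hθ x hxr y) (norm_nonneg _))
      rw [hx] at h1
      have := abs_le.1 h1
      exact ⟨by linarith, by linarith⟩
    refine (variance_le_sq_of_bounded hbd (hm _ (hseq k)).const_inner.aemeasurable).trans_eq ?_
    ring
  have hto : Tendsto (fun k => (‖v‖ * (K * ‖θseq k - θ‖)) ^ 2) atTop (𝓝 0) := by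
    have := (((tendsto_iff_norm_sub_tendsto_zero.1 hlim).const_mul K).const_mul ‖v‖).pow 2
    simpa using this
  exact absurd (ge_of_tendsto' hto hle) (not_le.2 hc)

/-! ### Localization of the empirical minimizer -/

theorem IsAugmentedSample.ae_norm_le {Ω : Type*} [MeasurableSpace Ω] {μ : Measure Ω}
    {P₀ P₁ Psyn : Measure (Vec p)} {n₀ n₁ m : ℕ} {X : SampleIdx n₀ n₁ m → Ω → Vec p}
    (hX : IsAugmentedSample μ P₀ P₁ Psyn X) {r : ℝ} (h₀ : ∀ᵐ x ∂P₀, ‖x‖ ≤ r)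
    (h₁ : ∀ᵐ x ∂P₁, ‖x‖ ≤ r) (hs : ∀ᵐ x ∂Psyn, ‖x‖ ≤ r) (i : SampleIdx n₀ n₁ m) :
    ∀ᵐ ω ∂μ, ‖X i ω‖ ≤ r := by
  refine ae_of_ae_map (hX.measurable i).aemeasurable (p := fun x => ‖x‖ ≤ r) ?_
  rw [hX.law i]
  rcases i with i | i | i
  · exact h₀
  · exact h₁
  · exact hs

/-- The estimator exists and is `n^{-1/2}`-close to the balanced minimizer, with probability close
to one. -/
theorem exists_localization.{u} {Θ : Set (Vec d)} {ℓ : Vec d → Vec p → Fin 2 → ℝ} {r K lam : ℝ}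
    (hb : LossBounds Θ ℓ r K) (hreg : LossRegular Θ ℓ) (hd : 0 < d) {P₀ P₁ : Measure (Vec p)}
    [IsProbabilityMeasure P₀] [IsProbabilityMeasure P₁] {Psyn : ℕ → Measure (Vec p)}
    [∀ k, IsProbabilityMeasure (Psyn k)] (h₀ : ∀ᵐ x ∂P₀, ‖x‖ ≤ r) (h₁ : ∀ᵐ x ∂P₁, ‖x‖ ≤ r)
    (hs : ∀ k, ∀ᵐ x ∂(Psyn k), ‖x‖ ≤ r) {n₀ n₁ m : ℕ → ℕ} (hpos : ∀ k, 0 < n₀ k)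
    (hn₀ : Tendsto n₀ atTop atTop) {θstar : Vec d} (hθ : θstar ∈ Θ) (hlam : 0 < lam)
    (hquad : ∀ k, ∀ θ ∈ Θ, syntheticRisk ℓ P₀ P₁ (Psyn k) (n₀ k) (n₁ k) (m k) θstar
      + ⟪∇ (syntheticRisk ℓ P₀ P₁ (Psyn k) (n₀ k) (n₁ k) (m k)) θstar, θ - θstar⟫
      + lam / 2 * ‖θ - θstar‖ ^ 2 ≤ syntheticRisk ℓ P₀ P₁ (Psyn k) (n₀ k) (n₁ k) (m k) θ)
    (hcrit : (fun k => ‖∇ (syntheticRisk ℓ P₀ P₁ (Psyn k) (n₀ k) (n₁ k) (m k)) θstar‖)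
      =o[atTop] fun k => 1 / √(n₀ k : ℝ))
    {Ω : ℕ → Type u} [∀ k, MeasurableSpace (Ω k)] {μ : ∀ k, Measure (Ω k)}
    [∀ k, IsProbabilityMeasure (μ k)]
    {X : ∀ k, SampleIdx (n₀ k) (n₁ k) (m k) → Ω k → Vec p} {θhat : ∀ k, Ω k → Vec d}
    (hX : ∀ k, IsAugmentedSample (μ k) P₀ P₁ (Psyn k) (X k))
    (hmin : ∀ k, IsEmpiricalMinimizer (μ k) Θ ℓ (X k) (θhat k)) {ε : ℝ} (hε : 0 < ε) :
    ∃ C : ℝ, 0 < C ∧ ∀ᶠ k in atTop,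
      μ k {ω | ¬ (IsArgmin (empiricalRisk ℓ fun i => X k i ω) Θ (θhat k ω) ∧
        ‖θhat k ω - θstar‖ ≤ C / √(n₀ k : ℝ))} ≤ ENNReal.ofReal ε := by
  obtain ⟨A, hA, hdev⟩ := hb.exists_sup_deviation.{u} hreg hθ hd hε
  -- `A` bounds the rescaled gradient deviation, and `1` the rescaled norm of `∇R̃(θ*)`.
  set C : ℝ := 2 * (A + 1) / lam with hC
  have hCpos : 0 < C := by positivity
  obtain ⟨ρ, hρ, hball⟩ := Metric.nhds_basis_closedBall.mem_iff.1 (hreg.isOpen.mem_nhds hθ)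
  have hsqrt : Tendsto (fun k => √(n₀ k : ℝ)) atTop atTop :=
    Real.tendsto_sqrt_atTop.comp (tendsto_natCast_atTop_atTop.comp hn₀)
  refine ⟨C, hCpos, ?_⟩
  filter_upwards [hcrit.bound zero_lt_one,
    (hsqrt.const_div_atTop C).eventually_le_const hρ] with k hk1 hk2
  have hn : (0 : ℝ) < n₀ k := by exact_mod_cast hpos k
  have hsq : 0 < √(n₀ k : ℝ) := Real.sqrt_pos.2 hn
  set N : ℝ := (n₀ k : ℝ) + n₁ k + m k with hN
  have hcard : (Fintype.card (SampleIdx (n₀ k) (n₁ k) (m k)) : ℝ) = N := by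
    simp [hN, add_assoc]
  have hnN : (n₀ k : ℝ) ≤ N := by
    have := Nat.cast_nonneg (α := ℝ) (n₁ k)
    have := Nat.cast_nonneg (α := ℝ) (m k)
    linarith
  have hNpos : 0 < N := hn.trans_le hnN
  have hXr := (hX k).ae_norm_le h₀ h₁ (hs k)
  have hbadset := hdev (Ω k) (μ k) (SampleIdx (n₀ k) (n₁ k) (m k)) sampleLabel (X k)
    (Nat.cast_pos.1 (hcard ▸ hNpos)) (hX k).indep (hX k).measurable hXr
  rw [hcard] at hbadset
  refine (measure_mono_ae ?_).trans hbadset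
  filter_upwards [hmin k] with ω hω hnot
  by_contra hgood
  refine hnot ?_
  have hgrad : ∀ θ ∈ Θ, HasGradientAt (syntheticRisk ℓ P₀ P₁ (Psyn k) (n₀ k) (n₁ k) (m k))
      (∇ (syntheticRisk ℓ P₀ P₁ (Psyn k) (n₀ k) (n₁ k) (m k)) θ) θ := fun θ hθ =>
    (hb.hasGradientAt_syntheticRisk hreg h₀ h₁ (hs k) _ _ _ hθ).differentiableAt.hasGradientAt
  have hclose : ∀ θ ∈ Θ, ‖(1 / N) • ∑ i, lossGrad ℓ θ (X k i ω) (sampleLabel i)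
      - ∇ (syntheticRisk ℓ P₀ P₁ (Psyn k) (n₀ k) (n₁ k) (m k)) θ‖ ≤ A / √(n₀ k : ℝ) := by
    intro θ hθ
    have hle : ‖(√N)⁻¹ • ∑ i, (lossGrad ℓ θ (X k i ω) (sampleLabel i)
        - ∫ ω, lossGrad ℓ θ (X k i ω) (sampleLabel i) ∂μ k)‖ ≤ A := by
      by_contra hlt
      exact hgood ⟨θ, hθ, not_le.1 hlt⟩
    have hmean : ∀ i, ∫ ω, lossGrad ℓ θ (X k i ω) (sampleLabel i) ∂μ k
        = meanGrad ℓ (sampleLaw P₀ P₁ (Psyn k) i) (sampleLabel i) θ := by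
      intro i
      rw [meanGrad, ← (hX k).law i, integral_map ((hX k).measurable i).aemeasurable
        (hreg.measurable_lossGrad hθ _).aestronglyMeasurable]
    simp_rw [hmean] at hle
    rw [(hb.hasGradientAt_syntheticRisk hreg h₀ h₁ (hs k) _ _ _ hθ).gradient,
      ← sum_meanGrad_sampleLaw, ← smul_sub, ← Finset.sum_sub_distrib]
    -- One factor `N^{-1/2}` normalizes the sum, the other gives the rate through `N ≥ n₀`.
    have hsplit : 1 / N = (√N)⁻¹ * (√N)⁻¹ := by
      rw [← mul_inv, Real.mul_self_sqrt hNpos.le, one_div]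
    rw [hsplit, mul_smul, norm_smul, norm_inv, Real.norm_of_nonneg (Real.sqrt_nonneg _),
      inv_mul_eq_div]
    exact div_le_div₀ hA.le hle hsq (Real.sqrt_le_sqrt hnN)
  have hcritk : ‖∇ (syntheticRisk ℓ P₀ P₁ (Psyn k) (n₀ k) (n₁ k) (m k)) θstar‖
      ≤ 1 / √(n₀ k : ℝ) := by
    simpa [abs_of_pos hsq] using hk1
  have hstab := exists_isArgmin_of_gradient_close hreg.convex hgrad
    (fun θ hθ => hreg.hasGradientAt_empiricalRisk (fun i => X k i ω) hθ) hlam hθ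
    (hquad k) hclose hcritk (ρ := C / √(n₀ k : ℝ))
    (le_of_eq (by rw [hC]; field_simp))
    ((Metric.closedBall_subset_closedBall hk2).trans hball)
  have hargmin := hω hstab.1
  exact ⟨hargmin, hstab.2 _ hargmin⟩

/-- Anti-concentration of the score at a fixed parameter: the majority observations alone prevent
`∑ ⟪v, ∇ℓ(θ; xᵢ, yᵢ)⟫` from concentrating at a scale below `√n₀`. -/
theorem exists_score_anticoncentration {Θ : Set (Vec d)} {ℓ : Vec d → Vec p → Fin 2 → ℝ}
    {r K : ℝ} (hb : LossBounds Θ ℓ r K) (hreg : LossRegular Θ ℓ) {P₀ P₁ : Measure (Vec p)}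
    [IsProbabilityMeasure P₀] {Psyn : ℕ → Measure (Vec p)} (h₀ : ∀ᵐ x ∂P₀, ‖x‖ ≤ r)
    {n₀ n₁ m : ℕ → ℕ} (hn₀ : Tendsto n₀ atTop atTop) {θ : Vec d} (hθ : θ ∈ Θ) {v : Vec d}
    (hvar : Var[fun x => ⟪v, lossGrad ℓ θ x 0⟫; P₀] ≠ 0)
    {Ω : ℕ → Type*} [∀ k, MeasurableSpace (Ω k)] {μ : ∀ k, Measure (Ω k)}
    {X : ∀ k, SampleIdx (n₀ k) (n₁ k) (m k) → Ω k → Vec p}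
    (hX : ∀ k, IsAugmentedSample (μ k) P₀ P₁ (Psyn k) (X k)) {ε : ℝ} (hε : 0 < ε) :
    ∃ c : ℝ, 0 < c ∧ ∀ᶠ k in atTop,
      μ k {ω | |⟪v, ∑ i, lossGrad ℓ θ (X k i ω) (sampleLabel i)⟫| < c * √(n₀ k : ℝ)}
        ≤ ENNReal.ofReal ε := by
  have hgm : ∀ y, Measurable fun x => ⟪v, lossGrad ℓ θ x y⟫ := fun y =>
    (hreg.measurable_lossGrad hθ y).const_inner
  set ν : Measure ℝ := P₀.map fun x => ⟪v, lossGrad ℓ θ x 0⟫ with hν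
  have : IsProbabilityMeasure ν := Measure.isProbabilityMeasure_map (hgm 0).aemeasurable
  have hmem : MemLp id 2 ν := by
    rw [hν, memLp_map_measure_iff (by fun_prop) (hgm 0).aemeasurable]
    exact MemLp.of_bound (hgm 0).aestronglyMeasurable (‖v‖ * K)
      (h₀.mono fun x hx => (norm_inner_le_norm _ _).trans
        (mul_le_mul_of_nonneg_left (hb.grad θ hθ x hx 0) (norm_nonneg _)))
  have hvarν : Var[id; ν] ≠ 0 := by
    rw [hν, variance_map (by fun_prop) (hgm 0).aemeasurable]
    exact hvar
  obtain ⟨c, hc, hev⟩ := exists_anticoncentration hmem hvarν hε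
  refine ⟨c, hc, ?_⟩
  filter_upwards [hn₀.eventually hev] with k hk
  simp_rw [inner_sum]
  -- The majority law does not vary with `k`, so one anti-concentration bound serves along `n₀ k`;
  -- minority and synthetic scores form the independent remainder.
  refine measure_abs_sum_add_lt_le (ν := ν)
    (Y := fun i ω => ⟪v, lossGrad ℓ θ (X k i ω) (sampleLabel i)⟫) ?_
    (fun i => (hgm _).comp ((hX k).measurable i)) (fun i => ?_) hk
  · exact (hX k).indep.comp (fun i x => ⟪v, lossGrad ℓ θ x (sampleLabel i)⟫) fun i => hgm _
  · have hlaw : (μ k).map (X k (Sum.inl i)) = P₀ := (hX k).law (Sum.inl i)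
    rw [hν, ← hlaw, Measure.map_map (hgm 0) ((hX k).measurable _)]
    rfl

end

/-! ### The excess risk -/

theorem theorem3 {d p : ℕ} (hd : 0 < d)
    (Θ : Set (Vec d)) (ℓ : Vec d → Vec p → Fin 2 → ℝ) (hreg : LossRegular Θ ℓ)
    (P₀ P₁ : Measure (Vec p)) [IsProbabilityMeasure P₀] [IsProbabilityMeasure P₁]
    (θstar : Vec d) (hθstar : IsArgmin (balancedRisk ℓ P₀ P₁) Θ θstar)
    (n₀ n₁ : ℕ → ℕ) (hn : ∀ k, n₁ k < n₀ k) (hn₀ : Tendsto n₀ atTop atTop)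
    (Psyn : ℕ → Measure (Vec p)) [∀ k, IsProbabilityMeasure (Psyn k)]
    (hcurv : ∀ k, ‖hessian (psi ℓ P₁ (Psyn k)) θstar‖
      ≤ lambdaMin (hessian (balancedRisk ℓ P₀ P₁) θstar))
    (hideal : (fun k => ‖∇ (psi ℓ P₁ (Psyn k)) θstar‖)
      =o[atTop] fun k => 1 / √(n₀ k : ℝ)) :
    (fun k => n₀ k - n₁ k) ∈ balancingSizes n₀ n₁ ∧
    ∀ m ∈ balancingSizes n₀ n₁,
      ∀ θtilde : ℕ → Vec d,
        (∀ k, IsArgmin (syntheticRisk ℓ P₀ P₁ (Psyn k) (n₀ k) (n₁ k) (m k)) Θ (θtilde k)) →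
        RiskConditions Θ ℓ P₀ P₁ Psyn n₀ n₁ m θstar θtilde →
      ∀ (Ω : ℕ → Type*) [∀ k, MeasurableSpace (Ω k)] (μ : ∀ k, Measure (Ω k))
        [∀ k, IsProbabilityMeasure (μ k)]
        (X : ∀ k, SampleIdx (n₀ k) (n₁ k) (m k) → Ω k → Vec p) (θhat : ∀ k, Ω k → Vec d),
        (∀ k, IsAugmentedSample (μ k) P₀ P₁ (Psyn k) (X k)) →
        (∀ k, IsEmpiricalMinimizer (μ k) Θ ℓ (X k) (θhat k)) →
        IsThetaP μ
          (fun k ω => balancedRisk ℓ P₀ P₁ (θhat k ω) - balancedRisk ℓ P₀ P₁ θstar)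
          (fun k => 1 / (n₀ k : ℝ)) := by

  refine ⟨?_, ?_⟩
  · have hzero : (fun k => (((n₀ k - n₁ k : ℕ) : ℝ)) - ((n₀ k : ℝ) - n₁ k)) = fun _ => 0 := by
      funext k
      rw [Nat.cast_sub (hn k).le, sub_self]
    show (fun k => (((n₀ k - n₁ k : ℕ) : ℝ)) - ((n₀ k : ℝ) - n₁ k)) =o[atTop] _
    rw [hzero]
    exact isLittleO_zero _ _
  intro m hm θtilde hθtilde hcond Ω _ μ _ X θhat hX hhat
  obtain ⟨r, h₀, h₁, hs⟩ := hcond.bounded_support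
  obtain ⟨K, hb⟩ := hreg.exists_lossBounds r
  obtain ⟨lam, hlam, hlower⟩ := hcond.syn_hessian_lower
  obtain ⟨L, hL, hgrowth⟩ := hcond.risk_quadratic_growth
  obtain ⟨lamc, hlamc, hcov⟩ := hcond.cov_lower
  have hK := hb.pos
  have hθ := hθstar.1
  have hpos : ∀ k, 0 < n₀ k := fun k => (Nat.zero_le _).trans_lt (hn k)
  have hsqrt : Tendsto (fun k => √(n₀ k : ℝ)) atTop atTop :=
    Real.tendsto_sqrt_atTop.comp (tendsto_natCast_atTop_atTop.comp hn₀)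
  have hRgrad := fun θ (hθ : θ ∈ Θ) => hb.hasGradientAt_balancedRisk hreg h₀ h₁ hθ
  have hSgrad := fun k θ (hθ : θ ∈ Θ) =>
    hb.hasGradientAt_syntheticRisk hreg h₀ h₁ (hs k) (n₀ k) (n₁ k) (m k) hθ
  have hRcrit := hθstar.hasGradientAt_eq_zero hreg.isOpen (hRgrad _ hθ)
  have hquad := fun k θ (hθ' : θ ∈ Θ) => quadratic_lower_bound_of_hessian hreg.convex
    (fun θ hθ => (hSgrad k θ hθ).differentiableAt) hlam (hlower k) hθ hθ'
  have himbalance : (fun k => |(m k : ℝ) - ((n₀ k : ℝ) - n₁ k)| / n₀ k * ‖meanGrad ℓ P₀ 0 θstar‖)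
      =o[atTop] fun k => 1 / √(n₀ k : ℝ) := by
    have hm' : (fun k => (m k : ℝ) - ((n₀ k : ℝ) - n₁ k)) =o[atTop] fun k => √(n₀ k : ℝ) := hm
    have h := (hm'.norm_left.mul_isBigO (isBigO_refl (fun k => 1 / (n₀ k : ℝ)) atTop)).const_mul_left
      ‖meanGrad ℓ P₀ 0 θstar‖
    refine (h.congr_left fun k => ?_).congr_right fun k => ?_
    · rw [Real.norm_eq_abs]; ring
    · have hn : (0 : ℝ) < n₀ k := by exact_mod_cast hpos k
      rw [mul_one_div, Real.sqrt_div_self']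
  have hcrit : (fun k => ‖∇ (syntheticRisk ℓ P₀ P₁ (Psyn k) (n₀ k) (n₁ k) (m k)) θstar‖)
      =o[atTop] fun k => 1 / √(n₀ k : ℝ) := by
    refine IsBigO.trans_isLittleO (IsBigO.of_bound 1 (Eventually.of_forall fun k => ?_))
      (himbalance.add hideal)
    rw [one_mul, norm_norm, (hSgrad k θstar hθ).gradient,
      hb.gradient_psi hreg h₁ (hs k) hθ]
    exact (norm_syntheticGrad_le (hpos k) hRcrit).trans (le_abs_self _)
  have hcrit0 : Tendsto (fun k =>
      ‖∇ (syntheticRisk ℓ P₀ P₁ (Psyn k) (n₀ k) (n₁ k) (m k)) θstar‖) atTop (𝓝 0) :=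
    hcrit.trans_tendsto (hsqrt.const_div_atTop 1)
  -- Strong convexity at `θ*` and minimality of `θ̃` give `lam / 2 * ‖θ̃ - θ*‖ ≤ ‖∇R̃(θ*)‖`.
  have htilde : Tendsto θtilde atTop (𝓝 θstar) := by
    rw [tendsto_iff_norm_sub_tendsto_zero]
    refine squeeze_zero (fun _ => norm_nonneg _) (fun k => ?_)
      (by simpa using hcrit0.const_mul (2 / lam))
    set g := ∇ (syntheticRisk ℓ P₀ P₁ (Psyn k) (n₀ k) (n₁ k) (m k)) θstar with hg
    have h1 := hquad k _ (hθtilde k).1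
    have h2 := (hθtilde k).2 _ hθ
    have h3 := (abs_le.1 (abs_real_inner_le_norm g (θtilde k - θstar))).1
    rcases (norm_nonneg (θtilde k - θstar)).eq_or_lt with h0 | h0
    · rw [← h0]; positivity
    · rw [div_mul_eq_mul_div, le_div_iff₀ hlam]
      have h4 : lam / 2 * ‖θtilde k - θstar‖ * ‖θtilde k - θstar‖
          ≤ ‖g‖ * ‖θtilde k - θstar‖ := by nlinarith
      have := le_of_mul_le_mul_right h4 h0
      linarith
  -- Any unit vector would do; one exists because `d > 0`.
  set v : Vec d := EuclideanSpace.basisFun (Fin d) ℝ ⟨0, hd⟩ with hv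
  have hv1 : ‖v‖ = 1 := (EuclideanSpace.basisFun (Fin d) ℝ).norm_eq_one _
  have hvar := hb.variance_inner_lossGrad_ne_zero hreg h₀ (y := 0) hθ (fun k => (hθtilde k).1)
    htilde (v := v) hlamc fun k => by
      have := (hcov k v (norm_ne_zero_iff.1 (by rw [hv1]; exact one_ne_zero))).1.le
      rwa [hv1, one_pow, mul_one] at this
  have hloc := fun {ε : ℝ} (hε : 0 < ε) =>
    exists_localization hb hreg hd h₀ h₁ hs hpos hn₀ hθ hlam hquad hcrit hX hhat hε
  refine ⟨fun ε hε => ?_, fun ε hε => ?_⟩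
  · obtain ⟨C, hC, hev⟩ := hloc hε
    refine ⟨K * C ^ 2, by positivity, ?_⟩
    filter_upwards [hev] with k hk
    refine (measure_mono fun ω hω => ?_).trans hk
    rintro ⟨hargmin, hdist⟩
    have hn' : (0 : ℝ) < n₀ k := by exact_mod_cast hpos k
    refine absurd (Set.mem_ofPred_eq ▸ hω : _ < _) (not_lt.2 ?_)
    have hup := sub_le_of_gradient_lipschitz hreg.convex hRgrad hK.le hθ hargmin.1 fun θ hθ' => by
      rw [← sub_zero (_ + _), ← hRcrit, add_sub_add_comm, ← smul_sub, ← smul_sub]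
      refine (norm_add_le _ _).trans ?_
      rw [norm_smul, norm_smul, Real.norm_of_nonneg (by norm_num)]
      have h1 := hb.meanGrad_lipschitz hreg h₀ hθ' hθ 0
      have h2 := hb.meanGrad_lipschitz hreg h₁ hθ' hθ 1
      linarith
    refine hup.trans ?_
    rw [abs_of_pos (by positivity), mul_assoc]
    refine mul_le_mul_of_nonneg_left ?_ hK.le
    calc ‖θhat k ω - θstar‖ ^ 2 ≤ (C / √(n₀ k : ℝ)) ^ 2 := by gcongr
      _ = C ^ 2 * (1 / n₀ k) := by rw [div_pow, Real.sq_sqrt hn'.le, mul_one_div]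
  · obtain ⟨C, hC, hev⟩ := hloc (half_pos hε)
    obtain ⟨c, hc, hev'⟩ := exists_score_anticoncentration hb hreg h₀ hn₀ hθ hvar hX (half_pos hε)
    refine ⟨L * (c / (3 * K)) ^ 2, by positivity, ?_⟩
    have hm' : (fun k => (m k : ℝ) - ((n₀ k : ℝ) - n₁ k)) =o[atTop] fun k => √(n₀ k : ℝ) := hm
    filter_upwards [hev, hev', hm'.bound zero_lt_one] with k hk hk' hmk
    have hn1 : (1 : ℝ) ≤ n₀ k := by exact_mod_cast hpos k
    have hn' : (0 : ℝ) < n₀ k := zero_lt_one.trans_le hn1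
    have hsq : 0 < √(n₀ k : ℝ) := Real.sqrt_pos.2 hn'
    set N : ℝ := (n₀ k : ℝ) + n₁ k + m k with hN
    -- In the class `𝒞`, eventually `m ≤ n₀ - n₁ + √n₀`, so `N ≤ 2 n₀ + √n₀ ≤ 3 n₀`.
    have hNle : N ≤ 3 * n₀ k := by
      have h1 : √(n₀ k : ℝ) ≤ n₀ k := Real.sqrt_le_iff.2 ⟨hn'.le, by nlinarith⟩
      rw [one_mul, Real.norm_eq_abs, Real.norm_of_nonneg hsq.le] at hmk
      have := (abs_le.1 hmk).2
      linarith
    have hNpos : 0 < N := by positivity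
    have hXall : ∀ᵐ ω ∂μ k, ∀ i, ‖X k i ω‖ ≤ r :=
      ae_all_iff.2 ((hX k).ae_norm_le h₀ h₁ (hs k))
    rw [← add_halves ε, ENNReal.ofReal_add (half_pos hε).le (half_pos hε).le]
    refine (measure_mono_ae ?_).trans ((measure_union_le _ _).trans (add_le_add hk hk'))
    filter_upwards [hXall] with ω hω hlt
    by_contra hnot
    obtain ⟨hgood, hscore⟩ := not_or.1 hnot
    obtain ⟨hargmin, -⟩ := not_not.1 hgood
    have hscore' : c * √(n₀ k : ℝ)
        ≤ |⟪v, ∑ i, lossGrad ℓ θstar (X k i ω) (sampleLabel i)⟫| := not_lt.1 hscore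
    have hlt' : |balancedRisk ℓ P₀ P₁ (θhat k ω) - balancedRisk ℓ P₀ P₁ θstar|
        < L * (c / (3 * K)) ^ 2 * |1 / (n₀ k : ℝ)| := hlt
    refine absurd hlt' (not_lt.2 ?_)
    have hzero := hargmin.hasGradientAt_eq_zero hreg.isOpen
      (hreg.hasGradientAt_empiricalRisk (fun i => X k i ω) hargmin.1)
    have hsum0 : ∑ i, lossGrad ℓ (θhat k ω) (X k i ω) (sampleLabel i) = 0 :=
      (smul_eq_zero_iff_right (one_div_pos.2 hNpos).ne').1 hzero
    have hsumle : ‖∑ i, lossGrad ℓ θstar (X k i ω) (sampleLabel i)‖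
        ≤ N * (K * ‖θhat k ω - θstar‖) := by
      rw [← sub_zero (∑ i, lossGrad ℓ θstar _ _), ← hsum0, ← Finset.sum_sub_distrib]
      refine (norm_sum_le_of_le _ fun i _ =>
        hb.grad_lipschitz _ hθ _ hargmin.1 _ (hω i) _).trans_eq ?_
      rw [Finset.sum_const, Finset.card_univ, nsmul_eq_mul, norm_sub_rev]
      simp [hN, add_assoc]
    -- Combines `c √n₀ ≤ |⟪v, total score at θ*⟫|` with the Lipschitz bound `3 n₀ K ‖θhat - θ*‖`;
    -- this is the source of `c / (3 * K)`.
    have hdist : c / (3 * K) / √(n₀ k : ℝ) ≤ ‖θhat k ω - θstar‖ := by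
      have h1 : c * √(n₀ k : ℝ) ≤ 3 * n₀ k * (K * ‖θhat k ω - θstar‖) := by
        refine hscore'.trans ((abs_real_inner_le_norm _ _).trans ?_)
        rw [hv1, one_mul]
        exact hsumle.trans (by gcongr)
      rw [div_div, div_le_iff₀ (by positivity)]
      refine le_of_mul_le_mul_right ?_ hsq
      calc c * √(n₀ k : ℝ) ≤ 3 * n₀ k * (K * ‖θhat k ω - θstar‖) := h1
        _ = ‖θhat k ω - θstar‖ * (3 * K * √(n₀ k : ℝ)) * √(n₀ k : ℝ) := by
          nth_rewrite 1 [← Real.mul_self_sqrt hn'.le]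
          ring
    have hlow := hgrowth _ hargmin.1
    rw [abs_of_pos (by positivity)]
    refine le_trans ?_ (hlow.trans (le_abs_self _))
    rw [mul_assoc]
    refine mul_le_mul_of_nonneg_left ?_ hL.le
    calc (c / (3 * K)) ^ 2 * (1 / n₀ k) = (c / (3 * K) / √(n₀ k : ℝ)) ^ 2 := by
          rw [div_pow _ (√_), Real.sq_sqrt hn'.le, mul_one_div]
      _ ≤ ‖θhat k ω - θstar‖ ^ 2 := by gcongr
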